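/- Let $n\ge 1$ and let $B$ be the closed Euclidean unit ball of $\mathbb R^n$, $\kappa_n=\mathcal H^n(B)$, where $\mathcal H^n$ is Lebesgue measure. For a non-empty compact convex set $K\subset\mathbb R^n$ the quermassintegrals $W_0(K),\dots,W_n(K)$ are the coefficients in the expansion $$\mathcal H^n(K+\rho B)=\sum_{i=0}^n\binom ni W_i(K)\,\rho^i\qquad(\rho\ge 0),$$ and $W_i(\emptyset)=0$. Let $f:\mathbb R^n\to[0,+\infty]$ be not identically zero, quasi-concave, upper semicontinuous, with $\lim_{\|x\|\to\infty}f(x)=0$, and log-concave, i.e. $f((1-\lambda)x+\lambda y)\ge f(x)^{1-\lambda}f(y)^{\lambda}$ for all $\lambda\in(0,1)$ and all $x,y$ with $f(x),f(y)>0$ (that is, $f\in\mathcal Q^n_0$). For $\rho>0$ put $$(\chi_B\oplus\rho\cdot f)(z)=\sup\{\chi_B(x)\,f(y)^\rho:\ z=x+\rho y\},\qquad \Psi(\rho)=\int_{\mathbb R^n}(\chi_B\oplus\rho\cdot f)(z)\,dz\in[0,+\infty],$$ and $\Psi(0)=\int\chi_B=\kappa_n$ (the same expression at $\rho=0$, with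 $f(y)^0=1$). Theorem 3.6 (Dual Steiner-type formula). For every $\rho>0$, as an identity in $[0,+\infty]$, $$\Psi(\rho)=\sum_{j=0}^n\binom nj\rho^{\,j+1}\int_0^{+\infty}W_{n-j}\big(\mathrm{cl}\{f>t\}\big)\,t^{\rho-1}\,dt .$$ Moreover the maximum $\max f\in(0,+\infty]$ is attained and, denoting by $K_f=\mathrm{cl}\{f>0\}$ the support of $f$, the limit $\Psi'(0^+)=\lim_{\rho\to0^+}\frac{\Psi(\rho)-\Psi(0)}{\rho}$ exists in the extended reals and $$\Psi'(0^+)=\begin{cases}\kappa_n\log(\max f)+n\,W_{n-1}(K_f), & \text{if }K_f\text{ is compact},\\ +\infty, & \text{otherwise},\end{cases}$$ where $\log(+\infty)=+\infty$. -/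

import Mathlib

open Set Filter Topology MeasureTheory
open scoped ENNReal Pointwise

/-- The closed Euclidean unit ball `B` of `ℝⁿ`. -/
def unitBall (n : ℕ) : Set (EuclideanSpace ℝ (Fin n)) :=
  Metric.closedBall 0 1

/-- The volume `κₙ` of the unit ball of `ℝⁿ`. -/
noncomputable def ballVolume (n : ℕ) : ℝ :=
  volume.real (unitBall n)

/-- `W 0, …, W n` are the normalised coefficients of the polynomial expansion
`ℋⁿ(K + ρ B) = ∑_{i ≤ n} (n choose i) Wᵢ ρⁱ`, `ρ ≥ 0` (the entries `W i` with `i > n` do not occur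
in the expansion and are set to zero). -/
def IsSteinerExpansion (n : ℕ) (K : Set (EuclideanSpace ℝ (Fin n))) (W : ℕ → ℝ) : Prop :=
  (∀ ρ : ℝ, 0 ≤ ρ →
    volume.real (K + ρ • unitBall n) = ∑ i ∈ Finset.range (n + 1), (n.choose i : ℝ) * W i * ρ ^ i) ∧
  ∀ i, n < i → W i = 0

/-- The coefficients of the expansion are determined by the set. -/
theorem IsSteinerExpansion.unique {n : ℕ} {K : Set (EuclideanSpace ℝ (Fin n))} {W W' : ℕ → ℝ}
    (h : IsSteinerExpansion n K W) (h' : IsSteinerExpansion n K W') : W = W' := by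
  have key : (∑ i ∈ Finset.range (n + 1), Polynomial.monomial i ((n.choose i : ℝ) * W i)) =
      ∑ i ∈ Finset.range (n + 1), Polynomial.monomial i ((n.choose i : ℝ) * W' i) := by
    apply Polynomial.eq_of_infinite_eval_eq
    refine (Set.Ici_infinite (0 : ℝ)).mono fun ρ hρ => ?_
    have := (h.1 ρ hρ).symm.trans (h'.1 ρ hρ)
    simpa [Polynomial.eval_finsetSum, Polynomial.eval_monomial] using this
  funext i
  rcases lt_or_ge n i with hi | hi
  · rw [h.2 i hi, h'.2 i hi]
  · have hc := congrArg (fun p => Polynomial.coeff p i) key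
    have hi' : i < n + 1 := by omega
    have hpos : (n.choose i : ℝ) ≠ 0 := by exact_mod_cast (Nat.choose_pos hi).ne'
    simpa [Polynomial.finsetSum_coeff, Polynomial.coeff_monomial, hi', hpos,
      Nat.not_lt.mpr hi, Nat.not_lt.mpr (Nat.succ_le_succ hi), (Nat.choose_pos hi).ne'] using hc

open Classical in
/-- The `i`-th quermassintegral `Wᵢ(K)` of a compact convex set `K ⊆ ℝⁿ`: the coefficient `Wᵢ` of
the polynomial expansion of `ρ ↦ ℋⁿ(K + ρ B)`. For `K = ∅` all of them are zero; on sets without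
such an expansion the value is irrelevant. -/
noncomputable def quermassintegral {n : ℕ} (i : ℕ) (K : Set (EuclideanSpace ℝ (Fin n))) : ℝ :=
  if h : ∃ W, IsSteinerExpansion n K W then h.choose i else 0

/-- The class `𝒬ⁿ`: functions `ℝⁿ → [0, ∞]`, not identically zero, quasi-concave, upper
semicontinuous, vanishing at infinity. -/
structure IsClassQ {n : ℕ} (f : EuclideanSpace ℝ (Fin n) → ℝ≥0∞) : Prop where
  ne_zero : ∃ x, f x ≠ 0
  quasiconcave : QuasiconcaveOn ℝ univ f
  upperSemicontinuous : UpperSemicontinuous f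
  vanishing : Tendsto f (cocompact (EuclideanSpace ℝ (Fin n))) (𝓝 0)

/-- Log-concavity of a function `ℝⁿ → [0, ∞]`. Only points where `f` is positive are compared, and
`∞ ^ a * v = ∞` for `a > 0`, `v > 0`. -/
def IsLogConcave {n : ℕ} (f : EuclideanSpace ℝ (Fin n) → ℝ≥0∞) : Prop :=
  ∀ x y, 0 < f x → 0 < f y → ∀ lam : ℝ, 0 < lam → lam < 1 →
    f x ^ (1 - lam) * f y ^ lam ≤ f ((1 - lam) • x + lam • y)

/-- The class `𝒬ⁿ₀` of the log-concave functions in `𝒬ⁿ`. -/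
structure IsClassQLog {n : ℕ} (f : EuclideanSpace ℝ (Fin n) → ℝ≥0∞) : Prop
    extends IsClassQ f where
  logConcave : IsLogConcave f

/-- The combination `s · f ⊕ t · g` in the class of log-concave functions,
`z ↦ sup {f(x)ˢ g(y)ᵗ : z = s x + t y}`. -/
noncomputable def logSum {n : ℕ} (s t : ℝ) (f g : EuclideanSpace ℝ (Fin n) → ℝ≥0∞)
    (z : EuclideanSpace ℝ (Fin n)) : ℝ≥0∞ :=
  ⨆ (x : EuclideanSpace ℝ (Fin n)) (y : EuclideanSpace ℝ (Fin n)) (_ : z = s • x + t • y),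
    f x ^ s * g y ^ t

/-- The characteristic function `χ_B` of the unit ball. -/
noncomputable def ballIndicator (n : ℕ) : EuclideanSpace ℝ (Fin n) → ℝ≥0∞ :=
  (unitBall n).indicator 1

/-- `Ψ(ρ) = I(χ_B ⊕ ρ · f)`. For `ρ = 0` and `f` not identically zero this is `I(χ_B) = κₙ`. -/
noncomputable def dualPsi {n : ℕ} (f : EuclideanSpace ℝ (Fin n) → ℝ≥0∞) (ρ : ℝ) : ℝ≥0∞ :=
  ∫⁻ z, logSum 1 ρ (ballIndicator n) f z

/-- The closed superlevel set `cl {f > t}`, `t ≥ 0`. For `t = 0` it is the support of `f`. -/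
def closedSuperlevel {n : ℕ} (f : EuclideanSpace ℝ (Fin n) → ℝ≥0∞) (t : ℝ) :
    Set (EuclideanSpace ℝ (Fin n)) :=
  closure {x | ENNReal.ofReal t < f x}

/-- The support `K_f = cl {f > 0}`. -/
def fnSupport {n : ℕ} (f : EuclideanSpace ℝ (Fin n) → ℝ≥0∞) : Set (EuclideanSpace ℝ (Fin n)) :=
  closure {x | 0 < f x}

/-!
The superlevel sets of `χ_B ⊕ ρ · f` are `B + ρ {f > t}` at height `t ^ ρ`, so the layer cake
formula gives `Ψ(ρ) = ρ ∫ vol(B + ρ K_t) t ^ (ρ - 1) dt` with `K_t = cl {f > t}`, and Steiner's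
formula for each `K_t` yields the dual Steiner formula. Steiner's formula itself, with
nonnegative coefficients, is first obtained for zonotopes in place of the ball: adding one
segment `ρ [-u, u]` to a convex body adds `ρ` times the measure of a projection to its volume.
Since the ball is a limit of zonotopes, and the coefficients of a polynomial of bounded degree
are determined continuously by finitely many of its values, the expansion passes to the limit.

For the derivative at `0`, let `m` be the maximum of `f`, or any smaller bound, and `0 < s < m`.
Bounding `vol(B + ρ K_t)` below by `vol(B + ρ K_s)` for `t < s` and by `κₙ` for `s < t < m`
gives `κₙ (m ^ ρ - s ^ ρ) + s ^ ρ vol(B + ρ K_s) ≤ Ψ(ρ)`, where the left side has derivative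
`κₙ log m + n W_{n-1}(K_s)` at `0`. As `s → 0` this meets the upper bound `m ^ ρ vol(B + ρ K_f)`
if `K_f` is compact; otherwise `n W_{n-1}(K_s)`, being at least a multiple of the diameter of
`K_s`, is unbounded.
-/

open scoped Polynomial

section PolynomialExpansion

/-- The coefficients of polynomials of degree at most `d` are fixed linear combinations of their
values at `0, …, d`; this is the weight of the value at `k` in the `i`-th coefficient. -/
noncomputable def interpolationWeight (d i k : ℕ) : ℝ :=
  (Lagrange.basis (Finset.range (d + 1)) (fun k : ℕ => (k : ℝ)) k).coeff i

theorem coeff_eq_sum_interpolationWeight_mul {d : ℕ} {p : ℝ[X]} (hp : p.natDegree ≤ d) (i : ℕ) :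
    p.coeff i = ∑ k ∈ Finset.range (d + 1), interpolationWeight d i k * p.eval (k : ℝ) := by
  have hdeg : p.degree < (Finset.range (d + 1)).card := by
    rw [Finset.card_range]
    exact (Polynomial.degree_le_of_natDegree_le hp).trans_lt (by exact_mod_cast d.lt_succ_self)
  conv_lhs => rw [Lagrange.eq_interpolate (Nat.cast_injective (R := ℝ).injOn) hdeg,
    Lagrange.interpolate_apply, Polynomial.finsetSum_coeff]
  exact Finset.sum_congr rfl fun k _ => by rw [Polynomial.coeff_C_mul, mul_comm]; rfl

/-- `g` agrees on `[0, ∞)` with a polynomial of degree at most `d` with nonnegative coefficients. -/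
def HasNonnegExpansion (d : ℕ) (g : ℝ → ℝ) : Prop :=
  ∃ p : ℝ[X], p.natDegree ≤ d ∧ (∀ i, 0 ≤ p.coeff i) ∧ ∀ ρ, 0 ≤ ρ → g ρ = p.eval ρ

theorem hasNonnegExpansion_const (d : ℕ) {c : ℝ} (hc : 0 ≤ c) :
    HasNonnegExpansion d fun _ => c := by
  refine ⟨Polynomial.C c, by simp, fun i => ?_, fun ρ _ => by simp⟩
  rw [Polynomial.coeff_C]
  split_ifs
  exacts [hc, le_rfl]

theorem HasNonnegExpansion.add_id_mul {d : ℕ} {g h : ℝ → ℝ} (hg : HasNonnegExpansion (d + 1) g)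
    (hh : HasNonnegExpansion d h) : HasNonnegExpansion (d + 1) fun ρ => g ρ + ρ * h ρ := by
  obtain ⟨p, hpd, hp, hgp⟩ := hg
  obtain ⟨q, hqd, hq, hhq⟩ := hh
  refine ⟨p + q * Polynomial.X, ?_, fun i => ?_, fun ρ hρ => ?_⟩
  · exact Polynomial.natDegree_add_le_of_degree_le hpd
      (Polynomial.natDegree_mul_le_of_le hqd Polynomial.natDegree_X_le)
  · rw [Polynomial.coeff_add]
    refine add_nonneg (hp i) ?_
    rcases i with _ | i
    · rw [Polynomial.coeff_mul_X_zero]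
    · rw [Polynomial.coeff_mul_X]
      exact hq i
  · simp only [hgp ρ hρ, hhq ρ hρ, Polynomial.eval_add, Polynomial.eval_mul_X, mul_comm ρ]

theorem HasNonnegExpansion.of_tendsto {ι : Type*} {l : Filter ι} [l.NeBot] {d : ℕ}
    {g : ι → ℝ → ℝ} {g₀ : ℝ → ℝ} (h : ∀ k, HasNonnegExpansion d (g k))
    (hg : ∀ ρ, 0 ≤ ρ → Tendsto (fun k => g k ρ) l (𝓝 (g₀ ρ))) : HasNonnegExpansion d g₀ := by
  choose p hpd hp hgp using h
  set c : ℕ → ℝ := fun i => ∑ m ∈ Finset.range (d + 1), interpolationWeight d i m * g₀ m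
  have hcoeff : ∀ i, Tendsto (fun k => (p k).coeff i) l (𝓝 (c i)) := fun i => by
    simp_rw [fun k => coeff_eq_sum_interpolationWeight_mul (hpd k) i]
    refine tendsto_finsetSum _ fun m _ => Tendsto.const_mul _ ?_
    simpa only [← hgp _ m m.cast_nonneg] using hg m m.cast_nonneg
  refine ⟨∑ i ∈ Finset.range (d + 1), Polynomial.monomial i (c i), ?_, fun j => ?_, fun ρ hρ => ?_⟩
  · exact Polynomial.natDegree_sum_le_of_forall_le _ _ fun i hi =>
      (Polynomial.natDegree_monomial_le _).trans (Finset.mem_range_succ_iff.1 hi)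
  · rw [Polynomial.finsetSum_coeff]
    refine Finset.sum_nonneg fun i _ => ?_
    rw [Polynomial.coeff_monomial]
    split_ifs
    exacts [ge_of_tendsto' (hcoeff i) fun k => hp k i, le_rfl]
  · refine tendsto_nhds_unique (hg ρ hρ) ?_
    simp_rw [fun k => hgp k ρ hρ,
      fun k => Polynomial.eval_eq_sum_range' (Nat.lt_succ_of_le (hpd k)),
      Polynomial.eval_finsetSum, Polynomial.eval_monomial]
    exact tendsto_finsetSum _ fun i _ => (hcoeff i).mul_const _

end PolynomialExpansion

section Zonotope

variable {E F : Type*} [NormedAddCommGroup E] [NormedSpace ℝ E] [NormedAddCommGroup F]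
  [NormedSpace ℝ F]

theorem segment_neg_self_eq_image (u : E) :
    segment ℝ (-u) u = (fun t : ℝ => t • u) '' Icc (-1) 1 := by
  have := image_segment ℝ (LinearMap.toSpanSingleton ℝ E u).toAffineMap (-1) 1
  rw [segment_eq_Icc (by norm_num)] at this
  simpa using this.symm

theorem image_segment_neg_self (A : E →ₗ[ℝ] F) (u : E) :
    A '' segment ℝ (-u) u = segment ℝ (-A u) (A u) := by
  simpa using image_segment ℝ A.toAffineMap (-u) u

theorem smul_segment_neg_self (r : ℝ) (u : E) :
    r • segment ℝ (-u) u = segment ℝ (-(r • u)) (r • u) :=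
  image_segment_neg_self (LinearMap.lsmul ℝ E r) u

theorem isCompact_segment_neg_self (u : E) : IsCompact (segment ℝ (-u) u) := by
  rw [segment_neg_self_eq_image]
  exact isCompact_Icc.image (by fun_prop)

/-- The Minkowski sum of the segments `[-u, u]` for `u` in a list. -/
def zonotope (l : List E) : Set E :=
  (l.map fun u => segment ℝ (-u) u).sum

theorem zonotope_nil : zonotope ([] : List E) = {0} := rfl

theorem zonotope_cons (u : E) (l : List E) : zonotope (u :: l) = segment ℝ (-u) u + zonotope l :=
  List.sum_cons

theorem isCompact_zonotope (l : List E) : IsCompact (zonotope l) := by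
  induction l with
  | nil => exact isCompact_singleton
  | cons u l ih =>
    rw [zonotope_cons]
    exact (isCompact_segment_neg_self u).add ih

theorem convex_zonotope (l : List E) : Convex ℝ (zonotope l) := by
  induction l with
  | nil => exact convex_singleton 0
  | cons u l ih =>
    rw [zonotope_cons]
    exact (convex_segment _ _).add ih

theorem image_zonotope (A : E →ₗ[ℝ] F) (l : List E) : A '' zonotope l = zonotope (l.map A) := by
  induction l with
  | nil => simp only [zonotope_nil, List.map_nil, image_singleton, map_zero]
  | cons u l ih => rw [List.map_cons, zonotope_cons, zonotope_cons, image_add, ih,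
      image_segment_neg_self]

end Zonotope

section Prism

theorem volume_add_Icc {s : Set ℝ} (hs : IsCompact s) (hc : Convex ℝ s) (hne : s.Nonempty)
    {r : ℝ} (hr : 0 ≤ r) : volume (s + Icc (-r) r) = volume s + ENNReal.ofReal (2 * r) := by
  have hle : sInf s ≤ sSup s := Real.sInf_le_sSup s hs.bddBelow hs.bddAbove
  rw [eq_Icc_of_connected_compact ⟨hne, hc.isPreconnected⟩ hs, Icc_add_Icc hle (by linarith),
    Real.volume_Icc, Real.volume_Icc, ← ENNReal.ofReal_add (by linarith) (by linarith)]
  congr 1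
  ring

theorem preimage_prodMk_add_prod_zero {F : Type*} [AddMonoid F] (K : Set (ℝ × F)) (I : Set ℝ)
    (y : F) : (fun x => (x, y)) ⁻¹' (K + I ×ˢ {0}) = (fun x => (x, y)) ⁻¹' K + I := by
  ext x
  simp only [mem_preimage, Set.mem_add, Prod.exists, mem_prod, mem_singleton_iff, Prod.mk_add_mk,
    Prod.mk.injEq]
  constructor
  · rintro ⟨a, b, hab, t, _, ⟨ht, rfl⟩, rfl, rfl⟩
    exact ⟨a, by simpa using hab, t, ht, rfl⟩
  · rintro ⟨a, ha, t, ht, rfl⟩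
    exact ⟨a, y, ha, t, 0, ⟨ht, rfl⟩, rfl, add_zero y⟩

/-- Fubini along the lines parallel to the first axis: each line that meets `K` gains length
`2 * r`. -/
theorem prod_measure_add_Icc_prod_zero {F : Type*} [NormedAddCommGroup F] [NormedSpace ℝ F]
    [MeasurableSpace F] [BorelSpace F] (ν : Measure F) [SFinite ν] {K : Set (ℝ × F)}
    (hK : IsCompact K) (hc : Convex ℝ K) {r : ℝ} (hr : 0 ≤ r) :
    volume.prod ν (K + Icc (-r) r ×ˢ {0}) =
      volume.prod ν K + ENNReal.ofReal (2 * r) * ν (Prod.snd '' K) := by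
  have hsnd : MeasurableSet (Prod.snd '' K) := (hK.image continuous_snd).measurableSet
  have hsum : MeasurableSet (K + Icc (-r) r ×ˢ ({0} : Set F)) :=
    (hK.add (isCompact_Icc.prod isCompact_singleton)).measurableSet
  rw [Measure.prod_apply_symm hsum, Measure.prod_apply_symm hK.measurableSet,
    ← lintegral_indicator_one hsnd, ← lintegral_const_mul _ (measurable_one.indicator hsnd),
    ← lintegral_add_right _ ((measurable_one.indicator hsnd).const_mul _)]
  refine lintegral_congr fun y => ?_
  rw [preimage_prodMk_add_prod_zero]
  by_cases hy : y ∈ Prod.snd '' K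
  · have hcompact : IsCompact ((fun x : ℝ => (x, y)) ⁻¹' K) :=
      Topology.IsClosedEmbedding.isCompact_preimage
        ⟨isEmbedding_prodMkLeft y, by
          rw [← image_univ, ← prod_singleton]; exact isClosed_univ.prod isClosed_singleton⟩ hK
    have hconvex : Convex ℝ ((fun x : ℝ => (x, y)) ⁻¹' K) := fun a ha b hb s t hs ht hst => by
      simpa [← add_smul, hst] using hc ha hb hs ht hst
    have hne : ((fun x : ℝ => (x, y)) ⁻¹' K).Nonempty := by
      obtain ⟨⟨x, y⟩, hxy, rfl⟩ := hy
      exact ⟨x, hxy⟩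
    rw [volume_add_Icc hcompact hconvex hne hr, indicator_of_mem hy, Pi.one_apply, mul_one]
  · have hempty : (fun x : ℝ => (x, y)) ⁻¹' K = ∅ :=
      eq_empty_of_forall_notMem fun x hx => hy ⟨(x, y), hx, rfl⟩
    rw [hempty, Set.empty_add, indicator_of_notMem hy, mul_zero, add_zero]

variable {E : Type*} [NormedAddCommGroup E] [NormedSpace ℝ E]

theorem exists_continuousLinearEquiv_real_prod {u : E} (hu : u ≠ 0) :
    ∃ (H : Submodule ℝ E) (e : E ≃L[ℝ] ℝ × H), e u = (1, 0) := by
  obtain ⟨φ, hφ⟩ := SeparatingDual.exists_eq_one (R := ℝ) hu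
  have hinv : Function.RightInverse (ContinuousLinearMap.toSpanSingleton ℝ u) φ := fun t => by
    simp [hφ]
  refine ⟨_, ContinuousLinearEquiv.equivOfRightInverse φ _ hinv, ?_⟩
  ext <;> simp [hφ]

theorem exists_isAddHaarMeasure_measureReal_eq {H : Type*} [NormedAddCommGroup H] [NormedSpace ℝ H]
    [MeasurableSpace E] [BorelSpace E] [MeasurableSpace H] [BorelSpace H] [FiniteDimensional ℝ H]
    (μ : Measure E) [μ.IsAddHaarMeasure] (e : E ≃L[ℝ] ℝ × H) :
    ∃ ν : Measure H, ν.IsAddHaarMeasure ∧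
      ∀ S : Set E, μ.real S = (volume.prod ν).real (e '' S) := by
  have : (μ.map e).IsAddHaarMeasure := e.isAddHaarMeasure_map μ
  set ν : Measure H := Measure.addHaar
  set c := Measure.addHaarScalarFactor (μ.map e) (volume.prod ν)
  have hc : c ≠ 0 := (Measure.addHaarScalarFactor_pos_of_isAddHaarMeasure _ _).ne'
  have hμ : μ.map e = volume.prod (c • ν) := by
    rw [Measure.isAddLeftInvariant_eq_smul (μ.map e) (volume.prod ν),
      Measure.prod_smul_right]
  refine ⟨c • ν, Measure.IsAddHaarMeasure.nnreal_smul _ hc, fun S => ?_⟩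
  rw [← hμ, measureReal_def, measureReal_def]
  congr 1
  exact ((e.toHomeomorph.measurableEmbedding.map_apply μ _).trans
    (congrArg μ (e.injective.preimage_image S))).symm

/-- `P` is a projection along `u`. As the slope is again the Haar measure of a convex body, one
dimension lower, one can induct on the number of segments of a zonotope. -/
theorem exists_measureReal_add_smul_segment [FiniteDimensional ℝ E] [MeasurableSpace E]
    [BorelSpace E] (μ : Measure E) [μ.IsAddHaarMeasure] {u : E} (hu : u ≠ 0) :
    ∃ (H : Submodule ℝ E) (P : E →ₗ[ℝ] H) (ν : Measure H), ν.IsAddHaarMeasure ∧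
      Module.finrank ℝ E = Module.finrank ℝ H + 1 ∧
      ∀ K : Set E, IsCompact K → Convex ℝ K → ∀ r : ℝ, 0 ≤ r →
        μ.real (K + r • segment ℝ (-u) u) = μ.real K + r * ν.real (P '' K) := by
  obtain ⟨H, e, he⟩ := exists_continuousLinearEquiv_real_prod hu
  obtain ⟨ν, hν, hμν⟩ := exists_isAddHaarMeasure_measureReal_eq μ e
  refine ⟨H, (LinearMap.snd ℝ ℝ H).comp e.toLinearMap, (2 : NNReal) • ν,
    Measure.IsAddHaarMeasure.nnreal_smul _ two_ne_zero, ?_, fun K hK hKc r hr => ?_⟩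
  · rw [e.toLinearEquiv.finrank_eq, Module.finrank_prod, Module.finrank_self, add_comm]
  · have hseg : e '' (r • segment ℝ (-u) u) = Icc (-r) r ×ˢ {0} := by
      rw [smul_segment_neg_self, prod_singleton, ← segment_eq_Icc (by linarith),
        Prod.image_mk_segment_left]
      exact (image_segment_neg_self e.toLinearMap _).trans (by simp [he])
    have heK : IsCompact (e '' K) := hK.image e.continuous
    have hsnd : ν (Prod.snd '' (e '' K)) ≠ ⊤ := (heK.image continuous_snd).measure_ne_top
    rw [hμν, hμν, image_add, hseg, measureReal_def,
      prod_measure_add_Icc_prod_zero ν heK (hKc.linear_image e.toLinearMap) hr,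
      ENNReal.toReal_add heK.measure_ne_top (ENNReal.mul_ne_top ENNReal.ofReal_ne_top hsnd),
      ENNReal.toReal_mul, ENNReal.toReal_ofReal (by positivity), LinearMap.coe_comp, image_comp]
    rw [measureReal_nnreal_smul_apply, measureReal_def, measureReal_def, NNReal.coe_ofNat,
      mul_comm 2, mul_assoc]
    rfl

theorem hasNonnegExpansion_zonotope [FiniteDimensional ℝ E] [MeasurableSpace E] [BorelSpace E]
    (μ : Measure E) [μ.IsAddHaarMeasure] (l : List E) {K : Set E} (hK : IsCompact K)
    (hKc : Convex ℝ K) :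
    HasNonnegExpansion (Module.finrank ℝ E) fun ρ => μ.real (K + ρ • zonotope l) := by
  induction hl : l.length generalizing E with
  | zero =>
    obtain rfl := List.length_eq_zero_iff.1 hl
    simpa only [zonotope_nil, smul_set_singleton, smul_zero, add_singleton, add_zero, image_id']
      using hasNonnegExpansion_const _ measureReal_nonneg
  | succ N ih =>
    obtain ⟨u, l, rfl⟩ := List.exists_cons_of_length_eq_add_one hl
    have hl' : l.length = N := by simpa using hl
    rcases eq_or_ne u 0 with rfl | hu
    · simpa [zonotope_cons] using ih μ l hK hKc hl'
    obtain ⟨H, P, ν, hν, hdim, hslope⟩ := exists_measureReal_add_smul_segment μ hu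
    have hE := ih μ l hK hKc hl'
    have hH := ih ν (l.map P) (hK.image P.continuous_of_finiteDimensional) (hKc.linear_image P)
      ((List.length_map P).trans hl')
    rw [hdim] at hE ⊢
    obtain ⟨p, hpd, hp, hpK⟩ := hE.add_id_mul hH
    refine ⟨p, hpd, hp, fun ρ hρ => ?_⟩
    rw [← hpK ρ hρ]
    beta_reduce
    rw [zonotope_cons, smul_add, add_left_comm, add_comm, hslope _
      (hK.add ((isCompact_zonotope l).smul ρ)) (hKc.add ((convex_zonotope l).smul ρ)) ρ hρ,
      image_add, image_smul_set, image_zonotope]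

end Prism

theorem exists_simpleFunc_integral_norm_sub_lt {Ω E : Type*} [MeasurableSpace Ω] {μ : Measure Ω}
    [NormedAddCommGroup E] {f : Ω → E} (hf : Integrable f μ) {δ : ℝ} (hδ : 0 < δ) :
    ∃ s : SimpleFunc Ω E, Integrable s μ ∧ ∫ ω, ‖s ω - f ω‖ ∂μ < δ := by
  obtain ⟨s, hlt, hs⟩ := (memLp_one_iff_integrable.2 hf).exists_simpleFunc_eLpNorm_sub_lt
    ENNReal.one_ne_top (ε := ENNReal.ofReal δ) (by simpa using hδ)
  have hsint : Integrable s μ := memLp_one_iff_integrable.1 hs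
  refine ⟨s, hsint, ?_⟩
  rw [eLpNorm_sub_comm, eLpNorm_one_eq_lintegral_enorm] at hlt
  rw [show ∫ ω, ‖s ω - f ω‖ ∂μ = _ from
    integral_norm_eq_lintegral_enorm (hsint.sub hf).aestronglyMeasurable]
  exact (ENNReal.lt_ofReal_iff_toReal_lt (ne_top_of_lt hlt)).1 hlt

section Zonoid

variable {E : Type*} [NormedAddCommGroup E] [InnerProductSpace ℝ E]

/-- The support function of `zonotope l`. -/
def zonotopeSupport (l : List E) (v : E) : ℝ :=
  (l.map fun u => |inner ℝ u v|).sum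

theorem zonotopeSupport_cons (u : E) (l : List E) (v : E) :
    zonotopeSupport (u :: l) v = |inner ℝ u v| + zonotopeSupport l v :=
  List.sum_cons

theorem inner_le_zonotopeSupport {l : List E} {x : E} (hx : x ∈ zonotope l) (v : E) :
    inner ℝ x v ≤ zonotopeSupport l v := by
  induction l generalizing x with
  | nil =>
    obtain rfl : x = 0 := hx
    exact (inner_zero_left v).le
  | cons u l ih =>
    rw [zonotope_cons, segment_neg_self_eq_image] at hx
    obtain ⟨_, ⟨t, ht, rfl⟩, z, hz, rfl⟩ := hx
    rw [inner_add_left, real_inner_smul_left, zonotopeSupport_cons]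
    refine add_le_add ((le_abs_self _).trans ?_) (ih hz)
    rw [abs_mul]
    exact mul_le_of_le_one_left (abs_nonneg _) (abs_le.2 ht)

theorem exists_mem_zonotope_inner_eq_zonotopeSupport (l : List E) (v : E) :
    ∃ x ∈ zonotope l, inner ℝ x v = zonotopeSupport l v := by
  induction l with
  | nil => exact ⟨0, rfl, inner_zero_left v⟩
  | cons u l ih =>
    obtain ⟨z, hz, hzv⟩ := ih
    rw [zonotope_cons, zonotopeSupport_cons, ← hzv]
    rcases le_total 0 (inner ℝ u v) with h | h
    · refine ⟨u + z, add_mem_add (right_mem_segment ℝ _ _) hz, ?_⟩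
      rw [inner_add_left, abs_of_nonneg h]
    · refine ⟨-u + z, add_mem_add (left_mem_segment ℝ _ _) hz, ?_⟩
      rw [inner_add_left, inner_neg_left, abs_of_nonpos h]

theorem zonotope_subset_closedBall {l : List E} {R : ℝ} (hR : 0 ≤ R)
    (h : ∀ v, zonotopeSupport l v ≤ R * ‖v‖) : zonotope l ⊆ Metric.closedBall 0 R := by
  intro x hx
  have hxx := (inner_le_zonotopeSupport hx x).trans (h x)
  rw [real_inner_self_eq_norm_mul_norm] at hxx
  rw [mem_closedBall_zero_iff]
  rcases (norm_nonneg x).eq_or_lt with h0 | h0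
  exacts [h0 ▸ hR, le_of_mul_le_mul_right hxx h0]

theorem closedBall_subset_zonotope [CompleteSpace E] {l : List E} {R : ℝ}
    (h : ∀ v, R * ‖v‖ ≤ zonotopeSupport l v) : Metric.closedBall 0 R ⊆ zonotope l := by
  intro x hx
  by_contra hxZ
  obtain ⟨φ, s, hφZ, hφx⟩ := geometric_hahn_banach_closed_point (convex_zonotope l)
    (isCompact_zonotope l).isClosed hxZ
  obtain ⟨v, rfl⟩ := (InnerProductSpace.toDual ℝ E).surjective φ
  simp only [InnerProductSpace.toDual_apply_apply] at hφZ hφx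
  obtain ⟨z, hz, hzv⟩ := exists_mem_zonotope_inner_eq_zonotopeSupport l v
  have hxv : inner ℝ v x ≤ R * ‖v‖ := by
    rw [mul_comm]
    exact (real_inner_le_norm v x).trans
      (mul_le_mul_of_nonneg_left (mem_closedBall_zero_iff.1 hx) (norm_nonneg v))
  have hzs : inner ℝ v z < s := hφZ z hz
  rw [real_inner_comm, hzv] at hzs
  linarith [h v]

theorem exists_zonotopeSupport_eq_integral {Ω : Type*} [MeasurableSpace Ω] {μ : Measure Ω}
    (s : SimpleFunc Ω E) (hs : Integrable s μ) {c : ℝ} (hc : 0 ≤ c) :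
    ∃ l : List E, ∀ v, zonotopeSupport l v = c * ∫ ω, |inner ℝ (s ω) v| ∂μ := by
  refine ⟨s.range.toList.map fun y => (c * μ.real (s ⁻¹' {y})) • y, fun v => ?_⟩
  have hint : ∫ ω, |inner ℝ (s ω) v| ∂μ =
      ∑ y ∈ s.range, μ.real (s ⁻¹' {y}) • |inner ℝ y v| := by
    rw [← SimpleFunc.map_integral s (fun y => |inner ℝ y v|) hs (by simp),
      SimpleFunc.integral_eq_integral _ (hs.inner_const v).abs]
    rfl
  rw [hint, Finset.mul_sum, ← Finset.sum_map_toList, zonotopeSupport, List.map_map]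
  congr 1
  refine List.map_congr_left fun y _ => ?_
  rw [Function.comp_apply, real_inner_smul_left, abs_mul, abs_of_nonneg (by positivity),
    smul_eq_mul, mul_assoc]

theorem abs_integral_abs_inner_sub_le {Ω : Type*} [MeasurableSpace Ω] {μ : Measure Ω} {f g : Ω → E}
    (hf : Integrable f μ) (hg : Integrable g μ) (v : E) :
    |(∫ ω, |inner ℝ (f ω) v| ∂μ) - ∫ ω, |inner ℝ (g ω) v| ∂μ| ≤
      (∫ ω, ‖f ω - g ω‖ ∂μ) * ‖v‖ := by
  have hf' : Integrable (fun ω => |inner ℝ (f ω) v|) μ := (hf.inner_const v).abs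
  have hg' : Integrable (fun ω => |inner ℝ (g ω) v|) μ := (hg.inner_const v).abs
  rw [← integral_sub hf' hg', ← integral_mul_const]
  refine abs_integral_le_integral_abs.trans ?_
  refine integral_mono (hf'.sub hg').abs ((hf.sub hg).norm.mul_const _) fun ω => ?_
  refine (abs_abs_sub_abs_le _ _).trans ?_
  rw [← inner_sub_left]
  exact abs_real_inner_le_norm _ _

variable [FiniteDimensional ℝ E] [MeasurableSpace E] [BorelSpace E]

/-- The reflection exchanging `v` and `w` preserves the ball and its volume. -/
theorem setIntegral_closedBall_abs_inner_congr {v w : E} (h : ‖v‖ = ‖w‖) :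
    ∫ u in Metric.closedBall (0 : E) 1, |inner ℝ u v| =
      ∫ u in Metric.closedBall (0 : E) 1, |inner ℝ u w| := by
  set T := (ℝ ∙ (v - w))ᗮ.reflection
  have hTv : T v = w := Submodule.reflection_sub h
  have hT : MeasurePreserving T := T.measurePreserving
  rw [← hT.setIntegral_preimage_emb T.toHomeomorph.measurableEmbedding (fun u => |inner ℝ u w|),
    LinearIsometryEquiv.preimage_closedBall, map_zero]
  simp only [← hTv, LinearIsometryEquiv.inner_map_map]

theorem setIntegral_closedBall_abs_inner_pos {e : E} (he : e ≠ 0) :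
    0 < ∫ u in Metric.closedBall (0 : E) 1, |inner ℝ u e| := by
  have hcont : Continuous fun u : E => |inner ℝ u e| := by fun_prop
  rw [setIntegral_pos_iff_support_of_nonneg_ae (ae_of_all _ fun _ => abs_nonneg _)
    (hcont.continuousOn.integrableOn_compact (isCompact_closedBall _ _))]
  refine LT.lt.trans_le ?_ (measure_mono (inter_subset_inter_right _ Metric.ball_subset_closedBall))
  refine (hcont.isOpen_support.inter Metric.isOpen_ball).measure_pos volume
    ⟨(2 * ‖e‖)⁻¹ • e, ?_, ?_⟩
  · simp [inner_smul_left, he]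
  · rw [mem_ball_zero_iff, norm_smul, norm_inv, norm_mul, norm_norm, mul_inv, mul_assoc,
      inv_mul_cancel₀ (norm_ne_zero_iff.2 he)]
    norm_num

theorem exists_setIntegral_closedBall_abs_inner_eq [Nontrivial E] :
    ∃ c : ℝ, 0 < c ∧ ∀ v : E, ∫ u in Metric.closedBall (0 : E) 1, |inner ℝ u v| = c * ‖v‖ := by
  obtain ⟨e, he⟩ := exists_norm_eq E zero_le_one
  have he0 : e ≠ 0 := norm_ne_zero_iff.1 (he ▸ one_ne_zero)
  refine ⟨_, setIntegral_closedBall_abs_inner_pos he0, fun v => ?_⟩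
  have hv : ‖v‖ = ‖‖v‖ • e‖ := by rw [norm_smul, he, mul_one, norm_norm]
  rw [setIntegral_closedBall_abs_inner_congr hv, mul_comm, ← integral_const_mul]
  simp only [real_inner_smul_right, abs_mul, abs_norm]

/-- The ball is a zonoid: `‖v‖` is proportional to `∫ |⟪u, v⟫| du` over the ball, and approximating
the identity by simple functions turns this integral into the support function of a zonotope. -/
theorem exists_zonotope_approx_closedBall {ε : ℝ} (hε : 0 < ε) :
    ∃ l : List E, Metric.closedBall 0 (1 - ε) ⊆ zonotope l ∧
      zonotope l ⊆ Metric.closedBall 0 (1 + ε) := by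
  rcases subsingleton_or_nontrivial E with hE | hE
  · refine ⟨[], fun x _ => Subsingleton.elim x 0, ?_⟩
    rw [zonotope_nil, singleton_subset_iff]
    exact Metric.mem_closedBall_self (by positivity)
  obtain ⟨c, hc, hcv⟩ := exists_setIntegral_closedBall_abs_inner_eq (E := E)
  set μ := (volume : Measure E).restrict (Metric.closedBall 0 1)
  have hid : Integrable (fun u : E => u) μ :=
    continuous_id.continuousOn.integrableOn_compact (isCompact_closedBall _ _)
  obtain ⟨s, hsint, hs⟩ := exists_simpleFunc_integral_norm_sub_lt hid (mul_pos hc hε)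
  obtain ⟨l, hl⟩ := exists_zonotopeSupport_eq_integral s hsint (inv_nonneg.2 hc.le)
  have hclose : ∀ v, |zonotopeSupport l v - ‖v‖| ≤ ε * ‖v‖ := fun v => by
    have h := (abs_integral_abs_inner_sub_le hsint hid v).trans
      (mul_le_mul_of_nonneg_right hs.le (norm_nonneg v))
    rw [hcv, mul_assoc] at h
    have hdiff : zonotopeSupport l v - ‖v‖ = c⁻¹ * ((∫ u, |inner ℝ (s u) v| ∂μ) - c * ‖v‖) := by
      rw [hl, mul_sub, inv_mul_cancel_left₀ hc.ne']
    rwa [hdiff, abs_mul, abs_of_pos (inv_pos.2 hc), inv_mul_le_iff₀ hc]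
  refine ⟨l, closedBall_subset_zonotope fun v => ?_,
    zonotope_subset_closedBall (by positivity) fun v => ?_⟩
  · linarith [(abs_le.1 (hclose v)).1]
  · linarith [(abs_le.1 (hclose v)).2]

end Zonoid

section Steiner

theorem measureReal_smul_set {E : Type*} [NormedAddCommGroup E] [NormedSpace ℝ E]
    [FiniteDimensional ℝ E] [MeasurableSpace E] [BorelSpace E] (μ : Measure E) [μ.IsAddHaarMeasure]
    {r : ℝ} (hr : 0 ≤ r) (S : Set E) : μ.real (r • S) = r ^ Module.finrank ℝ E * μ.real S := by
  rw [measureReal_def, measureReal_def, Measure.addHaar_smul, ENNReal.toReal_mul,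
    ENNReal.toReal_ofReal (abs_nonneg _), abs_of_nonneg (by positivity)]

theorem smul_add_smul_subset {E : Type*} [AddCommGroup E] [Module ℝ E] {K B Z : Set E}
    (hKc : Convex ℝ K) (h0 : 0 ∈ K) {t : ℝ} (ht0 : 0 ≤ t) (ht1 : t ≤ 1) (hBZ : t • B ⊆ Z) (ρ : ℝ) :
    t • (K + ρ • B) ⊆ K + ρ • Z := by
  rw [smul_add, smul_comm t ρ]
  exact add_subset_add (image_subset_iff.2 fun x hx => hKc.smul_mem_of_zero_mem h0 hx ⟨ht0, ht1⟩)
    (smul_set_mono hBZ)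

theorem add_smul_subset_smul {E : Type*} [AddCommGroup E] [Module ℝ E] {K B Z : Set E}
    (hKc : Convex ℝ K) (h0 : 0 ∈ K) {t : ℝ} (ht : 1 ≤ t) (hZB : Z ⊆ t • B) (ρ : ℝ) :
    K + ρ • Z ⊆ t • (K + ρ • B) := by
  have ht0 : 0 < t := by positivity
  rw [smul_add, smul_comm t ρ]
  refine add_subset_add (fun x hx => ?_) (smul_set_mono hZB)
  rw [mem_smul_set_iff_inv_smul_mem₀ ht0.ne']
  exact hKc.smul_mem_of_zero_mem h0 hx ⟨by positivity, inv_le_one_of_one_le₀ ht⟩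

variable {E : Type*} [NormedAddCommGroup E] [InnerProductSpace ℝ E] [FiniteDimensional ℝ E]
  [MeasurableSpace E] [BorelSpace E] {K : Set E}

theorem hasNonnegExpansion_closedBall_of_zero_mem (hK : IsCompact K) (hKc : Convex ℝ K)
    (h0 : 0 ∈ K) : HasNonnegExpansion (Module.finrank ℝ E)
      fun ρ => volume.real (K + ρ • Metric.closedBall (0 : E) 1) := by
  set B := Metric.closedBall (0 : E) 1
  have hB : IsCompact B := isCompact_closedBall _ _
  obtain ⟨ε, -, hε, hlim⟩ := exists_seq_strictAnti_tendsto' (zero_lt_one (α := ℝ))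
  choose l hl hl' using fun k => exists_zonotope_approx_closedBall (E := E) (hε k).1
  refine .of_tendsto (l := atTop) (fun k => hasNonnegExpansion_zonotope volume (l k) hK hKc)
    fun ρ _ => ?_
  set V := volume.real (K + ρ • B)
  have hlower : Tendsto (fun k => (1 - ε k) ^ Module.finrank ℝ E * V) atTop (𝓝 V) := by
    simpa using ((hlim.const_sub 1).pow (Module.finrank ℝ E)).mul_const V
  have hupper : Tendsto (fun k => (1 + ε k) ^ Module.finrank ℝ E * V) atTop (𝓝 V) := by
    simpa using ((hlim.const_add 1).pow (Module.finrank ℝ E)).mul_const V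
  refine tendsto_of_tendsto_of_tendsto_of_le_of_le hlower hupper (fun k => ?_) (fun k => ?_)
  · have hsub : 0 ≤ 1 - ε k := sub_nonneg.2 (hε k).2.le
    beta_reduce
    rw [← measureReal_smul_set volume hsub]
    exact measureReal_mono (smul_add_smul_subset hKc h0 hsub (sub_le_self _ (hε k).1.le)
      (smul_unitClosedBall_of_nonneg (E := E) hsub ▸ hl k) ρ)
      (hK.add ((isCompact_zonotope _).smul ρ)).measure_ne_top
  · have hadd : 1 ≤ 1 + ε k := le_add_of_nonneg_right (hε k).1.le
    beta_reduce
    rw [← measureReal_smul_set volume (zero_le_one.trans hadd)]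
    exact measureReal_mono (add_smul_subset_smul hKc h0 hadd
      (smul_unitClosedBall_of_nonneg (E := E) (zero_le_one.trans hadd) ▸ hl' k) ρ)
      ((hK.add (hB.smul ρ)).smul (1 + ε k)).measure_ne_top

/-- **Steiner's formula.** -/
theorem hasNonnegExpansion_closedBall (hK : IsCompact K) (hKc : Convex ℝ K) :
    HasNonnegExpansion (Module.finrank ℝ E)
      fun ρ => volume.real (K + ρ • Metric.closedBall (0 : E) 1) := by
  rcases K.eq_empty_or_nonempty with rfl | ⟨x, hx⟩
  · simpa only [Set.empty_add, measureReal_empty] using hasNonnegExpansion_const _ le_rfl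
  · simpa only [vadd_add_assoc, measureReal_def, measure_vadd] using
      hasNonnegExpansion_closedBall_of_zero_mem (hK.vadd (-x)) (hKc.vadd (-x)) ⟨x, hx, by simp⟩

end Steiner

section Quermassintegral

variable {n : ℕ} {K : Set (EuclideanSpace ℝ (Fin n))}

theorem isCompact_unitBall (n : ℕ) : IsCompact (unitBall n) := isCompact_closedBall _ _

theorem convex_unitBall (n : ℕ) : Convex ℝ (unitBall n) := convex_closedBall _ _

theorem ballVolume_pos (n : ℕ) : 0 < ballVolume n :=
  ENNReal.toReal_pos (Metric.measure_closedBall_pos _ _ one_pos).ne'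
    (isCompact_unitBall n).measure_ne_top

theorem volume_real_smul_set {r : ℝ} (hr : 0 ≤ r) (S : Set (EuclideanSpace ℝ (Fin n))) :
    volume.real (r • S) = r ^ n * volume.real S := by
  rw [measureReal_smul_set volume hr, finrank_euclideanSpace_fin]

theorem hasNonnegExpansion_unitBall (hK : IsCompact K) (hKc : Convex ℝ K) :
    HasNonnegExpansion n fun ρ => volume.real (K + ρ • unitBall n) := by
  simpa only [finrank_euclideanSpace_fin, unitBall] using hasNonnegExpansion_closedBall hK hKc

theorem IsSteinerExpansion.quermassintegral_eq {W : ℕ → ℝ} (h : IsSteinerExpansion n K W) (i : ℕ) :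
    quermassintegral i K = W i := by
  have hex : ∃ W, IsSteinerExpansion n K W := ⟨W, h⟩
  rw [quermassintegral, dif_pos hex, hex.choose_spec.unique h]

theorem isSteinerExpansion_of_eq_eval {p : ℝ[X]} (hp : p.natDegree ≤ n)
    (h : ∀ ρ, 0 ≤ ρ → volume.real (K + ρ • unitBall n) = p.eval ρ) :
    IsSteinerExpansion n K fun i => p.coeff i / n.choose i := by
  refine ⟨fun ρ hρ => ?_, fun i hi => by simp [Nat.choose_eq_zero_of_lt hi]⟩
  rw [h ρ hρ, Polynomial.eval_eq_sum_range' (Nat.lt_succ_of_le hp)]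
  refine Finset.sum_congr rfl fun i hi => ?_
  have hchoose : (n.choose i : ℝ) ≠ 0 :=
    Nat.cast_ne_zero.2 (Nat.choose_pos (Finset.mem_range_succ_iff.1 hi)).ne'
  rw [mul_div_cancel₀ _ hchoose]

theorem volume_real_add_smul_unitBall (hK : IsCompact K) (hKc : Convex ℝ K) {ρ : ℝ} (hρ : 0 ≤ ρ) :
    volume.real (K + ρ • unitBall n) =
      ∑ i ∈ Finset.range (n + 1), (n.choose i : ℝ) * quermassintegral i K * ρ ^ i := by
  obtain ⟨p, hpd, -, hp⟩ := hasNonnegExpansion_unitBall hK hKc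
  have hW := isSteinerExpansion_of_eq_eval hpd hp
  simp_rw [hW.quermassintegral_eq]
  exact hW.1 ρ hρ

theorem quermassintegral_nonneg (hK : IsCompact K) (hKc : Convex ℝ K) (i : ℕ) :
    0 ≤ quermassintegral i K := by
  obtain ⟨p, hpd, hp0, hp⟩ := hasNonnegExpansion_unitBall hK hKc
  rw [(isSteinerExpansion_of_eq_eval hpd hp).quermassintegral_eq]
  exact div_nonneg (hp0 i) (Nat.cast_nonneg _)

theorem quermassintegral_eq_sum (hK : IsCompact K) (hKc : Convex ℝ K) (i : ℕ) :
    quermassintegral i K = (∑ k ∈ Finset.range (n + 1),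
      interpolationWeight n i k * volume.real (K + (k : ℝ) • unitBall n)) / n.choose i := by
  obtain ⟨p, hpd, -, hp⟩ := hasNonnegExpansion_unitBall hK hKc
  rw [(isSteinerExpansion_of_eq_eval hpd hp).quermassintegral_eq,
    coeff_eq_sum_interpolationWeight_mul hpd]
  simp only [← hp _ (Nat.cast_nonneg _)]

theorem aemeasurable_quermassintegral {K : ℝ → Set (EuclideanSpace ℝ (Fin n))}
    (hK : ∀ t, 0 < t → IsCompact (K t)) (hKc : ∀ t, 0 < t → Convex ℝ (K t))
    (hanti : AntitoneOn K (Ioi 0)) (i : ℕ) :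
    AEMeasurable (fun t => quermassintegral i (K t)) (volume.restrict (Ioi 0)) := by
  have hmeas : ∀ k : ℕ, AEMeasurable (fun t => volume.real (K t + (k : ℝ) • unitBall n))
      (volume.restrict (Ioi 0)) := fun k =>
    aemeasurable_restrict_of_antitoneOn measurableSet_Ioi fun s hs t ht hst =>
      measureReal_mono (add_subset_add_right (hanti hs ht hst))
        ((hK s hs).add ((isCompact_unitBall n).smul _)).measure_ne_top
  refine ((Finset.aemeasurable_fun_sum (Finset.range (n + 1)) fun k _ =>
    (hmeas k).const_mul (interpolationWeight n i k)).div_const (n.choose i : ℝ)).congr ?_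
  filter_upwards [self_mem_ae_restrict measurableSet_Ioi] with t ht
  exact (quermassintegral_eq_sum (hK t ht) (hKc t ht) i).symm

theorem tendsto_quermassintegral {ι : Type*} {l : Filter ι}
    {S : ι → Set (EuclideanSpace ℝ (Fin n))} (hS : ∀ k, IsCompact (S k))
    (hSc : ∀ k, Convex ℝ (S k)) (hK : IsCompact K) (hKc : Convex ℝ K)
    (h : ∀ ρ : ℝ, Tendsto (fun k => volume.real (S k + ρ • unitBall n)) l
      (𝓝 (volume.real (K + ρ • unitBall n)))) (i : ℕ) :
    Tendsto (fun k => quermassintegral i (S k)) l (𝓝 (quermassintegral i K)) := by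
  simp_rw [fun k => quermassintegral_eq_sum (hS k) (hSc k) i, quermassintegral_eq_sum hK hKc i]
  exact (tendsto_finsetSum _ fun (k : ℕ) _ => (h k).const_mul _).div_const _

end Quermassintegral

section DualSteinerPolynomial

variable {n : ℕ} {K : Set (EuclideanSpace ℝ (Fin n))}

/-- The polynomial `∑ⱼ (n choose j) W_{n-j}(K) ρʲ`, which gives the volume of `B + ρ K`. -/
noncomputable def dualSteinerPolynomial (K : Set (EuclideanSpace ℝ (Fin n))) : ℝ[X] :=
  ∑ j ∈ Finset.range (n + 1), Polynomial.monomial j (n.choose j * quermassintegral (n - j) K)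

theorem coeff_dualSteinerPolynomial (j : ℕ) :
    (dualSteinerPolynomial K).coeff j = n.choose j * quermassintegral (n - j) K := by
  simp only [dualSteinerPolynomial, Polynomial.finsetSum_coeff, Polynomial.coeff_monomial,
    Finset.sum_ite_eq', Finset.mem_range, ite_eq_left_iff, not_lt]
  intro hj
  rw [Nat.choose_eq_zero_of_lt hj, Nat.cast_zero, zero_mul]

theorem eval_dualSteinerPolynomial (ρ : ℝ) : (dualSteinerPolynomial K).eval ρ =
    ∑ j ∈ Finset.range (n + 1), n.choose j * quermassintegral (n - j) K * ρ ^ j := by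
  simp only [dualSteinerPolynomial, Polynomial.eval_finsetSum, Polynomial.eval_monomial]

theorem hasDerivAt_dualSteinerPolynomial_zero (K : Set (EuclideanSpace ℝ (Fin n))) :
    HasDerivAt (dualSteinerPolynomial K).eval (n * quermassintegral (n - 1) K) 0 := by
  have h := (dualSteinerPolynomial K).hasDerivAt 0
  rwa [← Polynomial.coeff_zero_eq_eval_zero, Polynomial.coeff_derivative,
    coeff_dualSteinerPolynomial, zero_add, Nat.choose_one_right, Nat.cast_zero, zero_add,
    mul_one] at h

theorem unitBall_add_smul_eq {ρ : ℝ} (hρ : ρ ≠ 0) (S : Set (EuclideanSpace ℝ (Fin n))) :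
    unitBall n + ρ • S = ρ • (S + ρ⁻¹ • unitBall n) := by
  rw [smul_add, smul_smul, mul_inv_cancel₀ hρ, one_smul, add_comm]

theorem isCompact_unitBall_add_smul (hK : IsCompact K) (ρ : ℝ) :
    IsCompact (unitBall n + ρ • K) :=
  (isCompact_unitBall n).add (hK.smul ρ)

theorem volume_real_unitBall_add_smul (hK : IsCompact K) (hKc : Convex ℝ K) {ρ : ℝ} (hρ : 0 < ρ) :
    volume.real (unitBall n + ρ • K) = (dualSteinerPolynomial K).eval ρ := by
  rw [unitBall_add_smul_eq hρ.ne', volume_real_smul_set hρ.le,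
    volume_real_add_smul_unitBall hK hKc (inv_nonneg.2 hρ.le), eval_dualSteinerPolynomial,
    Finset.mul_sum, ← Finset.sum_range_reflect]
  refine Finset.sum_congr rfl fun j hj => ?_
  have hjn : j ≤ n := Finset.mem_range_succ_iff.1 hj
  have hpow : ρ ^ n = ρ ^ j * ρ ^ (n - j) := by rw [← pow_add, Nat.add_sub_cancel' hjn]
  rw [Nat.add_sub_cancel, Nat.choose_symm hjn, inv_pow, hpow]
  field_simp

theorem ballVolume_le_volume_real_unitBall_add (hK : IsCompact K) (hne : K.Nonempty) :
    ballVolume n ≤ volume.real (unitBall n + K) := by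
  obtain ⟨x, hx⟩ := hne
  rw [ballVolume, measureReal_def, ← measure_vadd volume x]
  refine measureReal_mono ?_ ((isCompact_unitBall n).add hK).measure_ne_top
  rintro _ ⟨y, hy, rfl⟩
  exact mem_of_eq_of_mem (add_comm x y) (add_mem_add hy hx)

theorem volume_real_unitBall_add_smul_le {R ρ : ℝ} (hR : 0 ≤ R) (hKR : K ⊆ R • unitBall n)
    (hρ : 0 ≤ ρ) : volume.real (unitBall n + ρ • K) ≤ (1 + ρ * R) ^ n * ballVolume n := by
  have hsub : unitBall n + ρ • K ⊆ (1 + ρ * R) • unitBall n := by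
    rw [(convex_unitBall n).add_smul zero_le_one (by positivity), one_smul, mul_smul]
    exact add_subset_add_left (smul_set_mono hKR)
  rw [ballVolume, ← volume_real_smul_set (by positivity)]
  exact measureReal_mono hsub ((isCompact_unitBall n).smul _).measure_ne_top

theorem eval_zero_dualSteinerPolynomial (hK : IsCompact K) (hKc : Convex ℝ K)
    (hne : K.Nonempty) : (dualSteinerPolynomial K).eval 0 = ballVolume n := by
  obtain ⟨R, hR0, hKR⟩ := hK.isBounded.subset_closedBall_lt 0 0
  rw [← smul_unitClosedBall_of_nonneg hR0.le] at hKR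
  have hcont : Tendsto (dualSteinerPolynomial K).eval (𝓝[>] 0)
      (𝓝 ((dualSteinerPolynomial K).eval 0)) :=
    ((dualSteinerPolynomial K).continuous.tendsto 0).mono_left nhdsWithin_le_nhds
  have hupper : Tendsto (fun ρ : ℝ => (1 + ρ * R) ^ n * ballVolume n) (𝓝[>] 0)
      (𝓝 (ballVolume n)) :=
    (Continuous.tendsto' (by fun_prop) 0 _ (by simp)).mono_left nhdsWithin_le_nhds
  refine tendsto_nhds_unique hcont
    (tendsto_of_tendsto_of_tendsto_of_le_of_le' tendsto_const_nhds hupper ?_ ?_)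
  all_goals
    filter_upwards [self_mem_nhdsWithin] with ρ hρ
    rw [← volume_real_unitBall_add_smul hK hKc hρ]
  exacts [ballVolume_le_volume_real_unitBall_add (hK.smul ρ) hne.smul_set,
    volume_real_unitBall_add_smul_le hR0.le hKR (le_of_lt hρ)]

theorem volume_real_closedBall (x : EuclideanSpace ℝ (Fin n)) :
    volume.real (Metric.closedBall x 1) = ballVolume n :=
  congrArg ENNReal.toReal (Measure.addHaar_closedBall_center volume x 1)

theorem two_mul_ballVolume_le {x y : EuclideanSpace ℝ (Fin n)} (hK : IsCompact K) (hx : x ∈ K)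
    (hy : y ∈ K) (hxy : 2 < dist x y) : 2 * ballVolume n ≤ volume.real (unitBall n + K) := by
  have hdisj : Disjoint (Metric.closedBall x 1) (Metric.closedBall y 1) :=
    Metric.closedBall_disjoint_closedBall (by rwa [one_add_one_eq_two])
  have hsub : Metric.closedBall x 1 ∪ Metric.closedBall y 1 ⊆ unitBall n + K := by
    rw [← closedBall_zero_add_singleton 1 x, ← closedBall_zero_add_singleton 1 y]
    exact union_subset (add_subset_add_left (singleton_subset_iff.2 hx))
      (add_subset_add_left (singleton_subset_iff.2 hy))
  calc 2 * ballVolume n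
      = volume.real (Metric.closedBall x 1 ∪ Metric.closedBall y 1) := by
        rw [measureReal_union hdisj Metric.isClosed_closedBall.measurableSet
          (isCompact_closedBall _ _).measure_ne_top (isCompact_closedBall _ _).measure_ne_top,
          volume_real_closedBall, volume_real_closedBall, two_mul]
    _ ≤ _ := measureReal_mono hsub ((isCompact_unitBall n).add hK).measure_ne_top

/-- The volume is affine in `ρ`, and for `ρ = 2 / ‖u‖` the sum contains two disjoint balls. -/
theorem le_volume_real_unitBall_add_smul_segment (u : EuclideanSpace ℝ (Fin n)) {ρ : ℝ}
    (hρ : 0 ≤ ρ) : ballVolume n + ρ * (ballVolume n * ‖u‖ / 2) ≤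
      volume.real (unitBall n + ρ • segment ℝ (-u) u) := by
  rcases eq_or_ne u 0 with rfl | hu
  · simp [ballVolume]
  have hu' : 0 < ‖u‖ := norm_pos_iff.2 hu
  obtain ⟨_, P, ν, -, -, hslope⟩ := exists_measureReal_add_smul_segment volume hu
  have hB := hslope _ (isCompact_unitBall n) (convex_unitBall n)
  set r : ℝ := 2 / ‖u‖ with hr
  have hdist : dist (r • u) (r • -u) = 4 := by
    rw [dist_smul₀, dist_eq_norm, sub_neg_eq_add, ← two_smul ℝ u, norm_smul,
      Real.norm_of_nonneg (by positivity), Real.norm_two, hr]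
    field_simp
    norm_num
  have htwo := two_mul_ballVolume_le ((isCompact_segment_neg_self u).smul r)
    (smul_mem_smul_set (right_mem_segment ℝ (-u) u))
    (smul_mem_smul_set (left_mem_segment ℝ (-u) u)) (by rw [hdist]; norm_num)
  rw [hB r (by positivity), ← ballVolume, two_mul, add_le_add_iff_left, hr, div_mul_eq_mul_div,
    le_div_iff₀ hu'] at htwo
  rw [hB ρ hρ, ← ballVolume, add_le_add_iff_left]
  exact mul_le_mul_of_nonneg_left (by linarith) hρ

/-- A lower bound of the mean width by the diameter: `n W_{n-1}(K)` is the derivative at `0` of the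
volume of `B + ρ K`, which contains a translate of `B + ρ [-u, u]` with `u = (x - y) / 2`. -/
theorem ballVolume_mul_dist_le_quermassintegral (hK : IsCompact K) (hKc : Convex ℝ K)
    {x y : EuclideanSpace ℝ (Fin n)} (hx : x ∈ K) (hy : y ∈ K) :
    ballVolume n * dist x y / 4 ≤ n * quermassintegral (n - 1) K := by
  set u : EuclideanSpace ℝ (Fin n) := (2⁻¹ : ℝ) • (x - y) with hu
  set m : EuclideanSpace ℝ (Fin n) := (2⁻¹ : ℝ) • (x + y) with hm
  have hnorm : ‖u‖ = dist x y / 2 := by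
    rw [hu, norm_smul, dist_eq_norm, norm_inv, Real.norm_two, inv_mul_eq_div]
  have hsegment : ∀ z ∈ segment ℝ (-u) u, m + z ∈ K := by
    have hmy : m + -u = y := by rw [hm, hu]; module
    have hmx : m + u = x := by rw [hm, hu]; module
    refine image_subset_iff.1 ?_
    rw [segment_translate_image, hmy, hmx]
    exact hKc.segment_subset hy hx
  have hlower : ∀ ρ : ℝ, 0 < ρ →
      ballVolume n + ρ * (ballVolume n * ‖u‖ / 2) ≤ (dualSteinerPolynomial K).eval ρ := by
    intro ρ hρ
    rw [← volume_real_unitBall_add_smul hK hKc hρ]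
    refine (le_volume_real_unitBall_add_smul_segment u hρ.le).trans ?_
    rw [measureReal_def, ← measure_vadd volume (ρ • m)]
    refine measureReal_mono ?_ (isCompact_unitBall_add_smul hK ρ).measure_ne_top
    rintro _ ⟨_, ⟨b, hb, _, ⟨z, hz, rfl⟩, rfl⟩, rfl⟩
    refine ⟨b, hb, ρ • (m + z), smul_mem_smul_set (hsegment z hz), ?_⟩
    simp only [vadd_eq_add, smul_add]
    abel
  have hslope := (hasDerivAt_dualSteinerPolynomial_zero K).tendsto_slope_zero_right
  refine ge_of_tendsto hslope ?_
  filter_upwards [self_mem_nhdsWithin] with ρ hρ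
  have hρ' : (0 : ℝ) < ρ := hρ
  have hle := hlower ρ hρ
  rw [zero_add, eval_zero_dualSteinerPolynomial hK hKc ⟨x, hx⟩, smul_eq_mul, inv_mul_eq_div,
    le_div_iff₀ hρ']
  rw [hnorm] at hle
  linarith

end DualSteinerPolynomial

section LayerCake

variable {α : Type*} [MeasurableSpace α] {μ : Measure α} {g : α → ℝ≥0∞}

theorem lintegral_Ioi_rpow_eq_top (s : ℝ) : ∫⁻ t in Ioi (0 : ℝ), ENNReal.ofReal (t ^ s) = ⊤ := by
  by_contra h
  refine not_integrableOn_Ioi_rpow s ((lintegral_ofReal_ne_top_iff_integrable ?_ ?_).1 h)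
  · exact (by fun_prop : Measurable fun t : ℝ => t ^ s).aestronglyMeasurable
  · filter_upwards [self_mem_ae_restrict measurableSet_Ioi] with t ht
    exact Real.rpow_nonneg (le_of_lt ht) s

theorem lintegral_eq_lintegral_meas_rpow_lt_of_ne_top (hg : AEMeasurable g μ)
    (hfin : ∀ᵐ x ∂μ, g x ≠ ⊤) {ρ : ℝ} (hρ : 0 < ρ) :
    ∫⁻ x, g x ∂μ = ENNReal.ofReal ρ * ∫⁻ t in Ioi (0 : ℝ),
      μ {x | ENNReal.ofReal t ^ ρ < g x} * ENNReal.ofReal (t ^ (ρ - 1)) := by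
  have hcake := lintegral_rpow_eq_lintegral_meas_lt_mul μ
    (ae_of_all _ fun x => (ENNReal.toReal_nonneg : 0 ≤ (g x ^ ρ⁻¹).toReal))
    (hg.pow_const _).ennreal_toReal hρ
  have hpow : ∫⁻ x, g x ∂μ = ∫⁻ x, ENNReal.ofReal ((g x ^ ρ⁻¹).toReal ^ ρ) ∂μ := by
    refine lintegral_congr_ae ?_
    filter_upwards [hfin] with x hx
    rw [ENNReal.toReal_rpow, ENNReal.rpow_inv_rpow hρ.ne', ENNReal.ofReal_toReal hx]
  rw [hpow, hcake]
  congr 1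
  refine setLIntegral_congr_fun measurableSet_Ioi fun t ht => ?_
  congr 1
  refine measure_congr ?_
  filter_upwards [hfin] with x hx
  refine propext ?_
  have hx' : g x ^ ρ⁻¹ ≠ ⊤ := ENNReal.rpow_ne_top_of_nonneg (inv_nonneg.2 hρ.le) hx
  change t < (g x ^ ρ⁻¹).toReal ↔ ENNReal.ofReal t ^ ρ < g x
  rw [← ENNReal.ofReal_lt_iff_lt_toReal (le_of_lt ht) hx', ← ENNReal.rpow_lt_rpow_iff hρ,
    ENNReal.rpow_inv_rpow hρ.ne']

theorem lintegral_eq_lintegral_meas_rpow_lt (hg : AEMeasurable g μ) {ρ : ℝ} (hρ : 0 < ρ) :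
    ∫⁻ x, g x ∂μ = ENNReal.ofReal ρ * ∫⁻ t in Ioi (0 : ℝ),
      μ {x | ENNReal.ofReal t ^ ρ < g x} * ENNReal.ofReal (t ^ (ρ - 1)) := by
  by_cases htop : μ {x | g x = ⊤} = 0
  · exact lintegral_eq_lintegral_meas_rpow_lt_of_ne_top hg (measure_eq_zero_iff_ae_notMem.1 htop) hρ
  rw [lintegral_eq_top_of_measure_eq_top_ne_zero hg htop, eq_comm, eq_top_iff]
  calc ⊤ = ENNReal.ofReal ρ *
          ∫⁻ t in Ioi (0 : ℝ), μ {x | g x = ⊤} * ENNReal.ofReal (t ^ (ρ - 1)) := by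
        rw [lintegral_const_mul _ (by fun_prop), lintegral_Ioi_rpow_eq_top, ENNReal.mul_top htop,
          ENNReal.mul_top (ENNReal.ofReal_pos.2 hρ).ne']
    _ ≤ _ := by
        gcongr with t x
        rintro (hx : g x = ⊤)
        rw [hx]
        exact ENNReal.rpow_lt_top_of_nonneg hρ.le ENNReal.ofReal_ne_top

theorem lintegral_Ioo_rpow_sub_one {ρ : ℝ} (hρ : 0 < ρ) {a b : ℝ} (ha : 0 ≤ a) (hab : a ≤ b) :
    ENNReal.ofReal ρ * ∫⁻ t in Ioo a b, ENNReal.ofReal (t ^ (ρ - 1)) =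
      ENNReal.ofReal (b ^ ρ - a ^ ρ) := by
  have hint : IntervalIntegrable (fun t : ℝ => t ^ (ρ - 1)) volume a b :=
    intervalIntegral.intervalIntegrable_rpow' (by linarith)
  have hnonneg : 0 ≤ᵐ[volume.restrict (Ioc a b)] fun t : ℝ => t ^ (ρ - 1) := by
    filter_upwards [self_mem_ae_restrict measurableSet_Ioc] with t ht
    exact Real.rpow_nonneg (ha.trans ht.1.le) _
  rw [setLIntegral_congr Ioo_ae_eq_Ioc, ← ofReal_integral_eq_lintegral_ofReal
    ((intervalIntegrable_iff_integrableOn_Ioc_of_le hab).1 hint) hnonneg,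
    ← intervalIntegral.integral_of_le hab, integral_rpow (Or.inl (by linarith)),
    ← ENNReal.ofReal_mul hρ.le, sub_add_cancel, mul_div_cancel₀ _ hρ.ne']

theorem lintegral_Ioo_const_mul_rpow_sub_one {ρ : ℝ} (hρ : 0 < ρ) {a b c : ℝ} (ha : 0 ≤ a)
    (hab : a ≤ b) (hc : 0 ≤ c) :
    ENNReal.ofReal ρ * ∫⁻ t in Ioo a b, ENNReal.ofReal c * ENNReal.ofReal (t ^ (ρ - 1)) =
      ENNReal.ofReal (c * (b ^ ρ - a ^ ρ)) := by
  rw [lintegral_const_mul _ (by fun_prop), mul_left_comm, lintegral_Ioo_rpow_sub_one hρ ha hab,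
    ENNReal.ofReal_mul hc]

theorem ofReal_le_lintegral_Ioi_mul_rpow_sub_one {ρ : ℝ} (hρ : 0 < ρ) {v : ℝ → ℝ≥0∞}
    {a b s m : ℝ} (ha : 0 ≤ a) (hb : 0 ≤ b) (hs : 0 ≤ s) (hsm : s ≤ m)
    (hlow : ∀ t ∈ Ioo 0 s, ENNReal.ofReal b ≤ v t)
    (hhigh : ∀ t ∈ Ioo s m, ENNReal.ofReal a ≤ v t) :
    ENNReal.ofReal (a * (m ^ ρ - s ^ ρ) + b * s ^ ρ) ≤
      ENNReal.ofReal ρ * ∫⁻ t in Ioi (0 : ℝ), v t * ENNReal.ofReal (t ^ (ρ - 1)) := by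
  set w : ℝ → ℝ≥0∞ := fun t => ENNReal.ofReal (t ^ (ρ - 1))
  have hsub : Ioo s m ∪ Ioo 0 s ⊆ Ioi 0 :=
    union_subset (fun t ht => hs.trans_lt ht.1) fun t ht => ht.1
  have hdisj : Disjoint (Ioo s m) (Ioo 0 s) :=
    disjoint_left.2 fun t h1 h2 => lt_asymm h1.1 h2.2
  calc ENNReal.ofReal (a * (m ^ ρ - s ^ ρ) + b * s ^ ρ)
      = ENNReal.ofReal (a * (m ^ ρ - s ^ ρ)) + ENNReal.ofReal (b * (s ^ ρ - 0 ^ ρ)) := by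
        rw [Real.zero_rpow hρ.ne', sub_zero, ← ENNReal.ofReal_add]
        · exact mul_nonneg ha (sub_nonneg.2 (Real.rpow_le_rpow hs hsm hρ.le))
        · positivity
    _ = ENNReal.ofReal ρ * ((∫⁻ t in Ioo s m, ENNReal.ofReal a * w t) +
        ∫⁻ t in Ioo 0 s, ENNReal.ofReal b * w t) := by
        rw [mul_add, lintegral_Ioo_const_mul_rpow_sub_one hρ hs hsm ha,
          lintegral_Ioo_const_mul_rpow_sub_one hρ le_rfl hs hb]
    _ ≤ ENNReal.ofReal ρ * ((∫⁻ t in Ioo s m, v t * w t) + ∫⁻ t in Ioo 0 s, v t * w t) := by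
        gcongr ENNReal.ofReal ρ * (?_ + ?_)
        exacts [setLIntegral_mono' measurableSet_Ioo fun t ht => mul_le_mul_left (hhigh t ht) _,
          setLIntegral_mono' measurableSet_Ioo fun t ht => mul_le_mul_left (hlow t ht) _]
    _ = ENNReal.ofReal ρ * ∫⁻ t in Ioo s m ∪ Ioo 0 s, v t * w t := by
        rw [lintegral_union measurableSet_Ioo hdisj]
    _ ≤ ENNReal.ofReal ρ * ∫⁻ t in Ioi 0, v t * w t := by gcongr

end LayerCake

section Superlevel

variable {n : ℕ} {f : EuclideanSpace ℝ (Fin n) → ℝ≥0∞}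

theorem volume_add_closure {A C : Set (EuclideanSpace ℝ (Fin n))} (hC : Convex ℝ C)
    (hA : Convex ℝ A) : volume (C + closure A) = volume (C + A) := by
  refine le_antisymm ?_ (measure_mono (add_subset_add_left subset_closure))
  rw [← measure_closure_of_null_frontier ((hC.add hA).addHaar_frontier volume)]
  refine measure_mono ?_
  rintro _ ⟨x, hx, y, hy, rfl⟩
  exact map_mem_closure (f := fun y => x + y) (by fun_prop) hy fun z hz => add_mem_add hx hz

theorem setOf_rpow_lt_logSum {ρ : ℝ} (hρ : 0 < ρ) (d : ℝ≥0∞) :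
    {z | d ^ ρ < logSum 1 ρ (ballIndicator n) f z} = unitBall n + ρ • {y | d < f y} := by
  have hmem : ∀ {x y}, x ∈ unitBall n → (d ^ ρ < ballIndicator n x ^ (1 : ℝ) * f y ^ ρ ↔ d < f y) :=
    fun hx => by rw [ballIndicator, indicator_of_mem hx, Pi.one_apply, ENNReal.rpow_one, one_mul,
      ENNReal.rpow_lt_rpow_iff hρ]
  ext z
  simp only [logSum, mem_ofPred_eq, lt_iSup_iff, one_smul]
  constructor
  · rintro ⟨x, y, rfl, h⟩
    by_cases hx : x ∈ unitBall n
    · exact add_mem_add hx (smul_mem_smul_set ((hmem hx).1 h))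
    · simp [ballIndicator, indicator_of_notMem hx] at h
  · rintro ⟨x, hx, _, ⟨y, hy, rfl⟩, rfl⟩
    exact ⟨x, y, rfl, (hmem hx).2 hy⟩

theorem convex_setOf_lt (hf : QuasiconcaveOn ℝ univ f) (c : ℝ≥0∞) : Convex ℝ {x | c < f x} := by
  simpa only [mem_univ, true_and] using hf.convex_gt c

theorem aemeasurable_logSum (hf : QuasiconcaveOn ℝ univ f) {ρ : ℝ} (hρ : 0 < ρ) :
    AEMeasurable (logSum 1 ρ (ballIndicator n) f) := by
  refine NullMeasurable.aemeasurable (measurable_of_Ioi fun c => ?_)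
  have hsuper := setOf_rpow_lt_logSum (f := f) hρ (c ^ ρ⁻¹)
  rw [ENNReal.rpow_inv_rpow hρ.ne'] at hsuper
  have hconvex : Convex ℝ {z | c < logSum 1 ρ (ballIndicator n) f z} := by
    rw [hsuper]
    exact (convex_unitBall n).add ((convex_setOf_lt hf _).smul ρ)
  exact hconvex.nullMeasurableSet volume

theorem dualPsi_eq_lintegral (hf : QuasiconcaveOn ℝ univ f) {ρ : ℝ} (hρ : 0 < ρ) :
    dualPsi f ρ = ENNReal.ofReal ρ * ∫⁻ t in Ioi (0 : ℝ),
      volume (unitBall n + ρ • closedSuperlevel f t) * ENNReal.ofReal (t ^ (ρ - 1)) := by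
  rw [dualPsi, lintegral_eq_lintegral_meas_rpow_lt (aemeasurable_logSum hf hρ) hρ]
  simp only [setOf_rpow_lt_logSum hρ, closedSuperlevel, ← closure_smul₀,
    volume_add_closure (convex_unitBall n) ((convex_setOf_lt hf _).smul ρ)]

theorem dualPsi_zero : dualPsi f 0 = volume (unitBall n) := by
  rw [dualPsi, ← lintegral_indicator_one (isCompact_unitBall n).measurableSet]
  refine lintegral_congr fun z => ?_
  simp only [logSum, one_smul, zero_smul, add_zero, ENNReal.rpow_zero, mul_one, ENNReal.rpow_one,
    ballIndicator]
  refine le_antisymm (iSup_le fun x => iSup_le fun _ => iSup_le fun h => h ▸ le_rfl) ?_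
  exact le_iSup_of_le z (le_iSup_of_le 0 (le_iSup_of_le rfl le_rfl))

theorem antitone_closedSuperlevel : Antitone (closedSuperlevel f) := fun _ _ hst =>
  closure_mono fun _ hx => (ENNReal.ofReal_le_ofReal hst).trans_lt hx

theorem closedSuperlevel_subset_fnSupport (t : ℝ) : closedSuperlevel f t ⊆ fnSupport f :=
  closure_mono fun _ (hx : _ < f _) => pos_of_gt hx

theorem convex_closedSuperlevel (hf : QuasiconcaveOn ℝ univ f) (t : ℝ) :
    Convex ℝ (closedSuperlevel f t) := (convex_setOf_lt hf _).closure

theorem convex_fnSupport (hf : QuasiconcaveOn ℝ univ f) : Convex ℝ (fnSupport f) :=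
  (convex_setOf_lt hf 0).closure

theorem IsClassQ.isCompact_setOf_le (hf : IsClassQ f) {c : ℝ≥0∞} (hc : 0 < c) :
    IsCompact {x | c ≤ f x} := by
  obtain ⟨S, hS, hSc⟩ := mem_cocompact.1 (hf.vanishing.eventually_lt_const hc)
  refine hS.of_isClosed_subset (hf.upperSemicontinuous.isClosed_preimage c)
    fun x (hx : c ≤ f x) => ?_
  by_contra hxS
  exact (hSc hxS : f x < c).not_ge hx

theorem IsClassQ.isCompact_closedSuperlevel (hf : IsClassQ f) {t : ℝ} (ht : 0 < t) :
    IsCompact (closedSuperlevel f t) := by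
  have hcompact := hf.isCompact_setOf_le (ENNReal.ofReal_pos.2 ht)
  exact hcompact.of_isClosed_subset isClosed_closure
    (closure_minimal (fun x (hx : _ < f x) => hx.le) hcompact.isClosed)

theorem IsClassQ.exists_isGreatest (hf : IsClassQ f) : ∃ x₀, IsGreatest (range f) (f x₀) := by
  obtain ⟨x, hx⟩ := hf.ne_zero
  obtain ⟨x₀, hx₀, hmax⟩ := (hf.upperSemicontinuous.upperSemicontinuousOn _).exists_isMaxOn
    ⟨x, le_refl (f x)⟩ (hf.isCompact_setOf_le (pos_iff_ne_zero.2 hx))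
  refine ⟨x₀, mem_range_self x₀, forall_mem_range.2 fun y => ?_⟩
  rcases le_total (f x) (f y) with h | h
  exacts [hmax h, h.trans hx₀]

theorem volume_unitBall_add_smul_mul_eq_sum {K : Set (EuclideanSpace ℝ (Fin n))}
    (hK : IsCompact K) (hKc : Convex ℝ K) {ρ : ℝ} (hρ : 0 < ρ) (w : ℝ) :
    volume (unitBall n + ρ • K) * ENNReal.ofReal w = ∑ j ∈ Finset.range (n + 1),
      ((n.choose j : ℝ≥0∞) * ENNReal.ofReal (ρ ^ j)) *
        ENNReal.ofReal (quermassintegral (n - j) K * w) := by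
  have hW := quermassintegral_nonneg hK hKc
  rw [← ofReal_measureReal (isCompact_unitBall_add_smul hK ρ).measure_ne_top,
    volume_real_unitBall_add_smul hK hKc hρ, eval_dualSteinerPolynomial,
    ENNReal.ofReal_sum_of_nonneg fun j _ =>
      mul_nonneg (mul_nonneg (Nat.cast_nonneg _) (hW _)) (pow_nonneg hρ.le _), Finset.sum_mul]
  refine Finset.sum_congr rfl fun j _ => ?_
  rw [ENNReal.ofReal_mul (mul_nonneg (Nat.cast_nonneg _) (hW _)),
    ENNReal.ofReal_mul (Nat.cast_nonneg _), ENNReal.ofReal_mul (hW _), ENNReal.ofReal_natCast]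
  ring

theorem IsClassQ.dualPsi_eq_sum (hf : IsClassQ f) {ρ : ℝ} (hρ : 0 < ρ) :
    dualPsi f ρ = ∑ j ∈ Finset.range (n + 1),
      (n.choose j : ℝ≥0∞) * ENNReal.ofReal (ρ ^ (j + 1)) *
        ∫⁻ t in Ioi (0 : ℝ),
          ENNReal.ofReal (quermassintegral (n - j) (closedSuperlevel f t) * t ^ (ρ - 1)) := by
  have hmeas : ∀ j, AEMeasurable (fun t => ENNReal.ofReal
      (quermassintegral (n - j) (closedSuperlevel f t) * t ^ (ρ - 1))) (volume.restrict (Ioi 0)) :=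
    fun j => ((aemeasurable_quermassintegral (fun t ht => hf.isCompact_closedSuperlevel ht)
      (fun t _ => convex_closedSuperlevel hf.quasiconcave t)
      (antitone_closedSuperlevel.antitoneOn _) (n - j)).mul (by fun_prop)).ennreal_ofReal
  rw [dualPsi_eq_lintegral hf.quasiconcave hρ, setLIntegral_congr_fun measurableSet_Ioi fun t ht =>
    volume_unitBall_add_smul_mul_eq_sum (hf.isCompact_closedSuperlevel ht)
      (convex_closedSuperlevel hf.quasiconcave t) hρ (t ^ (ρ - 1)),
    lintegral_finsetSum' _ fun j _ => (hmeas j).const_mul _, Finset.mul_sum]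
  refine Finset.sum_congr rfl fun j _ => ?_
  rw [lintegral_const_mul' _ _ (ENNReal.mul_ne_top (ENNReal.natCast_ne_top _)
    ENNReal.ofReal_ne_top), pow_succ, ENNReal.ofReal_mul (by positivity)]
  ring

theorem IsClassQ.ofReal_le_dualPsi (hf : IsClassQ f) {x₀ : EuclideanSpace ℝ (Fin n)} {m s ρ : ℝ}
    (hm : ENNReal.ofReal m ≤ f x₀) (hs : 0 < s) (hsm : s ≤ m) (hρ : 0 < ρ) :
    ENNReal.ofReal (ballVolume n * (m ^ ρ - s ^ ρ) +
      volume.real (unitBall n + ρ • closedSuperlevel f s) * s ^ ρ) ≤ dualPsi f ρ := by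
  rw [dualPsi_eq_lintegral hf.quasiconcave hρ]
  refine ofReal_le_lintegral_Ioi_mul_rpow_sub_one hρ (ballVolume_pos n).le measureReal_nonneg
    hs.le hsm (fun t ht => ?_) fun t ht => ?_
  · rw [ofReal_measureReal (isCompact_unitBall_add_smul
      (hf.isCompact_closedSuperlevel hs) ρ).measure_ne_top]
    exact measure_mono (add_subset_add_left (smul_set_mono (antitone_closedSuperlevel ht.2.le)))
  · have ht0 : 0 < t := hs.trans ht.1
    have hx₀ : x₀ ∈ closedSuperlevel f t := subset_closure
      (((ENNReal.ofReal_lt_ofReal_iff (ht0.trans ht.2)).2 ht.2).trans_le hm)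
    exact ENNReal.ofReal_le_of_le_toReal (ballVolume_le_volume_real_unitBall_add
      ((hf.isCompact_closedSuperlevel ht0).smul ρ) ⟨_, smul_mem_smul_set hx₀⟩)

theorem closedSuperlevel_eq_empty {t : ℝ} (ht : ∀ x, f x ≤ ENNReal.ofReal t) :
    closedSuperlevel f t = ∅ :=
  closure_empty_iff _ |>.2 (eq_empty_of_forall_notMem fun x hx => (ht x).not_gt hx)

theorem dualPsi_le (hf : QuasiconcaveOn ℝ univ f) {m ρ : ℝ} (hm : 0 ≤ m)
    (hmax : ∀ x, f x ≤ ENNReal.ofReal m) (hρ : 0 < ρ) (hK : IsCompact (fnSupport f)) :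
    dualPsi f ρ ≤ ENNReal.ofReal (volume.real (unitBall n + ρ • fnSupport f) * m ^ ρ) := by
  set V := volume.real (unitBall n + ρ • fnSupport f)
  set w : ℝ → ℝ≥0∞ := fun t => ENNReal.ofReal (t ^ (ρ - 1))
  have hbound : ∀ t, volume (unitBall n + ρ • closedSuperlevel f t) * w t ≤
      (Iio m).indicator (fun t => ENNReal.ofReal V * w t) t := by
    intro t
    rcases lt_or_ge t m with ht | ht
    · rw [indicator_of_mem (mem_Iio.2 ht), ofReal_measureReal
        (isCompact_unitBall_add_smul hK ρ).measure_ne_top]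
      gcongr
      exact closedSuperlevel_subset_fnSupport t
    · rw [closedSuperlevel_eq_empty fun x => (hmax x).trans (ENNReal.ofReal_le_ofReal ht),
        smul_set_empty, add_empty, measure_empty, zero_mul]
      exact zero_le
  calc dualPsi f ρ
      ≤ ENNReal.ofReal ρ * ∫⁻ t in Ioi 0,
          (Iio m).indicator (fun t => ENNReal.ofReal V * w t) t := by
        rw [dualPsi_eq_lintegral hf hρ]
        gcongr with t
        exact hbound t
    _ = ENNReal.ofReal ρ * ∫⁻ t in Ioo 0 m, ENNReal.ofReal V * w t := by
        rw [setLIntegral_indicator measurableSet_Iio, inter_comm, Ioi_inter_Iio]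
    _ = ENNReal.ofReal (V * m ^ ρ) := by
        rw [lintegral_Ioo_const_mul_rpow_sub_one hρ le_rfl hm measureReal_nonneg,
          Real.zero_rpow hρ.ne', sub_zero]

end Superlevel

section DerivativeAtZero

variable {n : ℕ} {f : EuclideanSpace ℝ (Fin n) → ℝ≥0∞}

/-- The difference quotient of `Ψ` at `0`, with values in the extended reals. -/
noncomputable def dualPsiQuotient (f : EuclideanSpace ℝ (Fin n) → ℝ≥0∞) (ρ : ℝ) : EReal :=
  ((dualPsi f ρ : EReal) - (dualPsi f 0 : EReal)) / (ρ : EReal)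

theorem dualPsiQuotient_eq (f : EuclideanSpace ℝ (Fin n) → ℝ≥0∞) (ρ : ℝ) :
    dualPsiQuotient f ρ = ((dualPsi f ρ : EReal) - (ballVolume n : EReal)) / (ρ : EReal) := by
  rw [dualPsiQuotient, dualPsi_zero,
    ← ofReal_measureReal (isCompact_unitBall n).measure_ne_top, EReal.coe_ennreal_ofReal,
    max_eq_left measureReal_nonneg, ballVolume]

theorem coe_div_le_dualPsiQuotient {ρ x : ℝ} (hρ : 0 < ρ) (h : ENNReal.ofReal x ≤ dualPsi f ρ) :
    (((x - ballVolume n) / ρ : ℝ) : EReal) ≤ dualPsiQuotient f ρ := by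
  rw [dualPsiQuotient_eq, EReal.coe_div, EReal.coe_sub]
  refine EReal.div_le_div_right_of_nonneg (EReal.coe_nonneg.2 hρ.le) (EReal.sub_le_sub ?_ le_rfl)
  calc (x : EReal) ≤ (max x 0 : ℝ) := EReal.coe_le_coe_iff.2 (le_max_left x 0)
    _ = (ENNReal.ofReal x : EReal) := EReal.coe_ennreal_ofReal.symm
    _ ≤ (dualPsi f ρ : EReal) := EReal.coe_ennreal_le_coe_ennreal_iff.2 h

theorem dualPsiQuotient_le_coe_div {ρ x : ℝ} (hρ : 0 < ρ) (hx : 0 ≤ x)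
    (h : dualPsi f ρ ≤ ENNReal.ofReal x) :
    dualPsiQuotient f ρ ≤ (((x - ballVolume n) / ρ : ℝ) : EReal) := by
  rw [dualPsiQuotient_eq, EReal.coe_div, EReal.coe_sub]
  refine EReal.div_le_div_right_of_nonneg (EReal.coe_nonneg.2 hρ.le) (EReal.sub_le_sub ?_ le_rfl)
  calc (dualPsi f ρ : EReal)
      ≤ (ENNReal.ofReal x : EReal) := EReal.coe_ennreal_le_coe_ennreal_iff.2 h
    _ = (x : EReal) := by rw [EReal.coe_ennreal_ofReal, max_eq_left hx]

theorem tendsto_coe_div_of_hasDerivAt {g : ℝ → ℝ} {g' c : ℝ} (hg : HasDerivAt g g' 0)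
    (hc : g 0 = c) :
    Tendsto (fun ρ => (((g ρ - c) / ρ : ℝ) : EReal)) (𝓝[>] 0) (𝓝 (g' : EReal)) := by
  have hslope := hg.tendsto_slope_zero_right
  simp only [zero_add, hc, smul_eq_mul, inv_mul_eq_div] at hslope
  exact (continuous_coe_real_ereal.tendsto g').comp hslope

theorem hasDerivAt_dualSteinerPolynomial_mul_rpow {K : Set (EuclideanSpace ℝ (Fin n))}
    (hK : IsCompact K) (hKc : Convex ℝ K) (hne : K.Nonempty) {s : ℝ} (hs : 0 < s) :
    HasDerivAt (fun ρ => (dualSteinerPolynomial K).eval ρ * s ^ ρ)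
      (ballVolume n * Real.log s + n * quermassintegral (n - 1) K) 0 := by
  have h := (hasDerivAt_dualSteinerPolynomial_zero K).mul
    (Real.hasStrictDerivAt_const_rpow hs 0).hasDerivAt
  rw [Real.rpow_zero, mul_one, one_mul, eval_zero_dualSteinerPolynomial hK hKc hne, add_comm] at h
  exact h

theorem IsClassQ.eventually_lt_dualPsiQuotient (hf : IsClassQ f) {x₀ : EuclideanSpace ℝ (Fin n)}
    {m s : ℝ} (hm : ENNReal.ofReal m ≤ f x₀) (hs : 0 < s) (hsm : s < m) {a : EReal}
    (ha : a < (ballVolume n * Real.log m +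
      n * quermassintegral (n - 1) (closedSuperlevel f s) : ℝ)) :
    ∀ᶠ ρ in 𝓝[>] 0, a < dualPsiQuotient f ρ := by
  have hm0 : 0 < m := hs.trans hsm
  have hK := hf.isCompact_closedSuperlevel hs
  have hKc := convex_closedSuperlevel hf.quasiconcave s
  have hne : (closedSuperlevel f s).Nonempty :=
    ⟨x₀, subset_closure (((ENNReal.ofReal_lt_ofReal_iff hm0).2 hsm).trans_le hm)⟩
  set P := dualSteinerPolynomial (closedSuperlevel f s) with hP
  have hderiv : HasDerivAt (fun ρ : ℝ => ballVolume n * (m ^ ρ - s ^ ρ) + P.eval ρ * s ^ ρ)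
      (ballVolume n * Real.log m + n * quermassintegral (n - 1) (closedSuperlevel f s)) 0 := by
    refine ((((Real.hasStrictDerivAt_const_rpow hm0 0).hasDerivAt.sub
      (Real.hasStrictDerivAt_const_rpow hs 0).hasDerivAt).const_mul (ballVolume n)).add
      (hasDerivAt_dualSteinerPolynomial_mul_rpow hK hKc hne hs)).congr_deriv ?_
    rw [Real.rpow_zero, Real.rpow_zero]
    ring
  have hzero : ballVolume n * (m ^ (0 : ℝ) - s ^ (0 : ℝ)) + P.eval 0 * s ^ (0 : ℝ) =
      ballVolume n := by
    rw [Real.rpow_zero, Real.rpow_zero, hP, eval_zero_dualSteinerPolynomial hK hKc hne]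
    ring
  filter_upwards [(tendsto_coe_div_of_hasDerivAt hderiv hzero).eventually_const_lt ha,
    self_mem_nhdsWithin] with ρ hlt hρ
  have hle := hf.ofReal_le_dualPsi hm hs hsm.le hρ
  rw [volume_real_unitBall_add_smul hK hKc hρ] at hle
  exact hlt.trans_le (coe_div_le_dualPsiQuotient hρ hle)

theorem IsClassQ.tendsto_dualPsiQuotient_of_eq_top (hf : IsClassQ f)
    {x₀ : EuclideanSpace ℝ (Fin n)} (hx₀ : f x₀ = ⊤) :
    Tendsto (dualPsiQuotient f) (𝓝[>] 0) (𝓝 ⊤) := by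
  refine EReal.tendsto_nhds_top_iff_real.2 fun a => ?_
  set m := Real.exp ((a + 1) / ballVolume n) with hm
  have hm0 : 0 < m := Real.exp_pos _
  have hlog : ballVolume n * Real.log m = a + 1 := by
    rw [hm, Real.log_exp, mul_div_cancel₀ _ (ballVolume_pos n).ne']
  have hW := quermassintegral_nonneg (hf.isCompact_closedSuperlevel (half_pos hm0))
    (convex_closedSuperlevel hf.quasiconcave _) (n - 1)
  refine hf.eventually_lt_dualPsiQuotient (hx₀ ▸ le_top) (half_pos hm0) (half_lt_self hm0)
    (EReal.coe_lt_coe_iff.2 ?_)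
  have hnW := mul_nonneg (Nat.cast_nonneg n) hW
  linarith

theorem exists_lt_dist_of_not_isCompact_fnSupport (hK : ¬ IsCompact (fnSupport f))
    (x₀ : EuclideanSpace ℝ (Fin n)) (R : ℝ) : ∃ y, 0 < f y ∧ R < dist x₀ y := by
  by_contra! h
  refine hK (Metric.isCompact_of_isClosed_isBounded isClosed_closure
    (Bornology.IsBounded.closure ?_))
  refine (Metric.isBounded_closedBall (x := x₀) (r := R)).subset fun y hy => ?_
  exact Metric.mem_closedBall'.2 (h y hy)

theorem IsClassQ.tendsto_dualPsiQuotient_of_not_isCompact (hf : IsClassQ f)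
    (hK : ¬ IsCompact (fnSupport f)) : Tendsto (dualPsiQuotient f) (𝓝[>] 0) (𝓝 ⊤) := by
  refine EReal.tendsto_nhds_top_iff_real.2 fun a => ?_
  obtain ⟨x₀, hx₀⟩ := hf.ne_zero
  obtain ⟨m, -, hm0, hm⟩ := ENNReal.lt_iff_exists_real_btwn.1 (pos_iff_ne_zero.2 hx₀)
  obtain ⟨y, hy, hdist⟩ := exists_lt_dist_of_not_isCompact_fnSupport hK x₀
    (4 * (a - ballVolume n * Real.log m) / ballVolume n)
  obtain ⟨s, -, hs0, hs⟩ := ENNReal.lt_iff_exists_real_btwn.1 (lt_min hm0 hy)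
  obtain ⟨hsm, hsy⟩ := lt_min_iff.1 hs
  rw [ENNReal.ofReal_pos] at hs0 hm0
  rw [div_lt_iff₀ (ballVolume_pos n)] at hdist
  have hwidth := ballVolume_mul_dist_le_quermassintegral (hf.isCompact_closedSuperlevel hs0)
    (convex_closedSuperlevel hf.quasiconcave s) (subset_closure (hsm.trans hm))
    (subset_closure hsy)
  refine hf.eventually_lt_dualPsiQuotient hm.le hs0 ((ENNReal.ofReal_lt_ofReal_iff hm0).1 hsm)
    (EReal.coe_lt_coe_iff.2 ?_)
  linarith

theorem iUnion_setOf_ofReal_lt {s : ℕ → ℝ} (hlim : Tendsto s atTop (𝓝 0)) :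
    ⋃ k, {x | ENNReal.ofReal (s k) < f x} = {x | 0 < f x} := by
  ext x
  simp only [mem_iUnion, mem_ofPred_eq]
  refine ⟨fun ⟨_, hk⟩ => pos_of_gt hk, fun hx => ?_⟩
  have hlim' := ENNReal.tendsto_ofReal hlim
  rw [ENNReal.ofReal_zero] at hlim'
  exact (hlim'.eventually_lt_const hx).exists

theorem tendsto_volume_add_closedSuperlevel (hf : QuasiconcaveOn ℝ univ f) {s : ℕ → ℝ}
    (hanti : Antitone s) (hlim : Tendsto s atTop (𝓝 0)) {C : Set (EuclideanSpace ℝ (Fin n))}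
    (hC : Convex ℝ C) :
    Tendsto (fun k => volume (C + closedSuperlevel f (s k))) atTop
      (𝓝 (volume (C + fnSupport f))) := by
  have hmono : Monotone fun k => C + {x | ENNReal.ofReal (s k) < f x} := fun k l hkl =>
    add_subset_add_left fun x (hx : _ < f x) =>
      (ENNReal.ofReal_le_ofReal (hanti hkl)).trans_lt hx
  have h := tendsto_measure_iUnion_atTop (μ := volume) hmono
  rw [← Set.add_iUnion, iUnion_setOf_ofReal_lt hlim] at h
  simpa only [Function.comp_def, closedSuperlevel, fnSupport,
    volume_add_closure hC (convex_setOf_lt hf _)] using h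

theorem tendsto_quermassintegral_closedSuperlevel (hf : QuasiconcaveOn ℝ univ f)
    (hK : IsCompact (fnSupport f)) {s : ℕ → ℝ} (hanti : Antitone s)
    (hlim : Tendsto s atTop (𝓝 0)) (i : ℕ) :
    Tendsto (fun k => quermassintegral i (closedSuperlevel f (s k))) atTop
      (𝓝 (quermassintegral i (fnSupport f))) := by
  refine tendsto_quermassintegral
    (fun k => hK.of_isClosed_subset isClosed_closure (closedSuperlevel_subset_fnSupport _))
    (fun k => convex_closedSuperlevel hf _) hK (convex_fnSupport hf) (fun ρ => ?_) i
  simp only [add_comm _ (ρ • unitBall n)]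
  exact (ENNReal.tendsto_toReal (((isCompact_unitBall n).smul ρ).add hK).measure_ne_top).comp
    (tendsto_volume_add_closedSuperlevel hf hanti hlim ((convex_unitBall n).smul ρ))

theorem eventually_dualPsiQuotient_lt (hf : QuasiconcaveOn ℝ univ f) (hne : ∃ x, f x ≠ 0) {m : ℝ}
    (hm0 : 0 < m) (hmax : ∀ x, f x ≤ ENNReal.ofReal m) (hK : IsCompact (fnSupport f)) {a : EReal}
    (ha : (ballVolume n * Real.log m + n * quermassintegral (n - 1) (fnSupport f) : ℝ) < a) :
    ∀ᶠ ρ in 𝓝[>] 0, dualPsiQuotient f ρ < a := by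
  have hKc := convex_fnSupport hf
  have hKne : (fnSupport f).Nonempty := hne.imp fun x hx => subset_closure (pos_iff_ne_zero.2 hx)
  have hderiv := hasDerivAt_dualSteinerPolynomial_mul_rpow hK hKc hKne hm0
  have hzero : (dualSteinerPolynomial (fnSupport f)).eval 0 * m ^ (0 : ℝ) = ballVolume n := by
    rw [Real.rpow_zero, mul_one, eval_zero_dualSteinerPolynomial hK hKc hKne]
  filter_upwards [(tendsto_coe_div_of_hasDerivAt hderiv hzero).eventually_lt_const ha,
    self_mem_nhdsWithin] with ρ hlt hρ
  refine (dualPsiQuotient_le_coe_div hρ ?_ ?_).trans_lt hlt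
  all_goals rw [← volume_real_unitBall_add_smul hK hKc hρ]
  exacts [by positivity, dualPsi_le hf hm0.le hmax hρ hK]

theorem IsClassQ.tendsto_dualPsiQuotient_of_isCompact (hf : IsClassQ f)
    {x₀ : EuclideanSpace ℝ (Fin n)} {m : ℝ} (hm0 : 0 < m) (hm : f x₀ = ENNReal.ofReal m)
    (hmax : ∀ x, f x ≤ f x₀) (hK : IsCompact (fnSupport f)) :
    Tendsto (dualPsiQuotient f) (𝓝[>] 0) (𝓝 ((ballVolume n * Real.log m +
      n * quermassintegral (n - 1) (fnSupport f) : ℝ) : EReal)) := by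
  refine tendsto_order.2 ⟨fun a ha => ?_, fun a ha =>
    eventually_dualPsiQuotient_lt hf.quasiconcave hf.ne_zero hm0 (hm ▸ hmax) hK ha⟩
  obtain ⟨s, hanti, hs, hlim⟩ := exists_seq_strictAnti_tendsto' hm0
  have hW := ((tendsto_quermassintegral_closedSuperlevel hf.quasiconcave hK hanti.antitone hlim
    (n - 1)).const_mul (n : ℝ)).const_add (ballVolume n * Real.log m)
  obtain ⟨k, hk⟩ :=
    (((continuous_coe_real_ereal.tendsto _).comp hW).eventually_const_lt ha).exists
  exact hf.eventually_lt_dualPsiQuotient hm.ge (hs k).1 (hs k).2 hk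

theorem IsClassQ.tendsto_dualPsiQuotient_log_max (hf : IsClassQ f)
    {x₀ : EuclideanSpace ℝ (Fin n)} (hmax : ∀ x, f x ≤ f x₀) (hK : IsCompact (fnSupport f)) :
    Tendsto (dualPsiQuotient f) (𝓝[>] 0) (𝓝 ((ballVolume n : EReal) * ENNReal.log (f x₀) +
      ((n * quermassintegral (n - 1) (fnSupport f) : ℝ) : EReal))) := by
  obtain ⟨x, hx⟩ := hf.ne_zero
  have hpos : f x₀ ≠ 0 := ((pos_iff_ne_zero.2 hx).trans_le (hmax x)).ne'
  by_cases htop : f x₀ = ⊤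
  · rw [htop, ENNReal.log_top, EReal.coe_mul_top_of_pos (ballVolume_pos n), EReal.top_add_coe]
    exact hf.tendsto_dualPsiQuotient_of_eq_top htop
  · have hm0 : 0 < (f x₀).toReal := ENNReal.toReal_pos hpos htop
    have hm : f x₀ = ENNReal.ofReal (f x₀).toReal := (ENNReal.ofReal_toReal htop).symm
    rw [hm, ENNReal.log_ofReal_of_pos hm0, ← EReal.coe_mul, ← EReal.coe_add]
    exact hf.tendsto_dualPsiQuotient_of_isCompact hm0 hm hmax hK

end DerivativeAtZero

theorem theorem3p6_general (n : ℕ) (f : EuclideanSpace ℝ (Fin n) → ℝ≥0∞) (hf : IsClassQ f) :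
    (∀ ρ : ℝ, 0 < ρ →
      dualPsi f ρ = ∑ j ∈ Finset.range (n + 1),
        (n.choose j : ℝ≥0∞) * ENNReal.ofReal (ρ ^ (j + 1)) *
          ∫⁻ t in Ioi (0 : ℝ),
            ENNReal.ofReal (quermassintegral (n - j) (closedSuperlevel f t) * t ^ (ρ - 1))) ∧
    (∃ m : ℝ≥0∞, IsGreatest (range f) m ∧
      (IsCompact (fnSupport f) →
        Tendsto (fun ρ : ℝ => ((dualPsi f ρ : EReal) - (dualPsi f 0 : EReal)) / (ρ : EReal))
          (𝓝[>] 0)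
          (𝓝 ((ballVolume n : EReal) * ENNReal.log m +
            ((n * quermassintegral (n - 1) (fnSupport f) : ℝ) : EReal)))) ∧
      (¬ IsCompact (fnSupport f) →
        Tendsto (fun ρ : ℝ => ((dualPsi f ρ : EReal) - (dualPsi f 0 : EReal)) / (ρ : EReal))
          (𝓝[>] 0) (𝓝 ⊤))) := by
  obtain ⟨x₀, hx₀⟩ := hf.exists_isGreatest
  exact ⟨fun ρ hρ => hf.dualPsi_eq_sum hρ, f x₀, hx₀,
    hf.tendsto_dualPsiQuotient_log_max (forall_mem_range.1 hx₀.2),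
    hf.tendsto_dualPsiQuotient_of_not_isCompact⟩

theorem theorem3p6 (n : ℕ) (hn : 1 ≤ n) (f : EuclideanSpace ℝ (Fin n) → ℝ≥0∞)
    (hf : IsClassQLog f) :
    (∀ ρ : ℝ, 0 < ρ →
      dualPsi f ρ = ∑ j ∈ Finset.range (n + 1),
        (n.choose j : ℝ≥0∞) * ENNReal.ofReal (ρ ^ (j + 1)) *
          ∫⁻ t in Ioi (0 : ℝ),
            ENNReal.ofReal (quermassintegral (n - j) (closedSuperlevel f t) * t ^ (ρ - 1))) ∧
    (∃ m : ℝ≥0∞, IsGreatest (range f) m ∧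
      (IsCompact (fnSupport f) →
        Tendsto (fun ρ : ℝ => ((dualPsi f ρ : EReal) - (dualPsi f 0 : EReal)) / (ρ : EReal))
          (𝓝[>] 0)
          (𝓝 ((ballVolume n : EReal) * ENNReal.log m +
            ((n * quermassintegral (n - 1) (fnSupport f) : ℝ) : EReal)))) ∧
      (¬ IsCompact (fnSupport f) →
        Tendsto (fun ρ : ℝ => ((dualPsi f ρ : EReal) - (dualPsi f 0 : EReal)) / (ρ : EReal))
          (𝓝[>] 0) (𝓝 ⊤))) :=
  theorem3p6_general n f hf.toIsClassQ
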